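/- Let $m\in\mathbb N$ and $0<\lambda\le 1$. There is a constant $C=C(m,\lambda)>0$, depending only on $m$ and $\lambda$, such that the following holds. Let $r\ge 0$ be an integer with $m\ge r+2$, let $X=\{x_j\}_{j=0}^{m-1}$ be real points, possibly repeated, with $x_0\le x_1\le\dots\le x_{m-1}$ and $x_0<x_{m-1}$, put $I=[x_0,x_{m-1}]$, $|I|=x_{m-1}-x_0$, and suppose that $$x_{j+r+1}-x_j\ge\lambda|I|\qquad\text{for all } 0\le j\le m-r-2 .$$ Let $f\in C^{(r)}(I)$ be real-valued and let $$L_{m-1}(x;f)=f(x_0)+\sum_{j=1}^{m-1}[x_0,\dots,x_j;f]\,(x-x_0)\cdots(x-x_{j-1})$$ be its Hermite polynomial, where the divided differences are defined by $[y_0;f]=f(y_0)$ and, for $n\ge 1$ and $y_0\le\dots\le y_n$, by $[y_0,\dots,y_n;f]=f^{(n)}(y_0)/n!$ if $y_0=y_n$ and $[y_0,\dots,y_n;f]=\big([y_1,\dots,y_n;f]-[y_0,\dots,y_{n-1};f]\big)/(y_n-y_0)$ otherwise. Then $L_{m-1}(\cdot;f)$ is a polynomial of degree $\le m-1$ with $L_{m-1}^{(l_j-1)}(x_j;f)=f^{(l_j-1)}(x_j)$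 for $0\le j\le m-1$, where $l_j$ is the number of $i\le j$ with $x_i=x_j$. Moreover, for every $x\in I$ and every permutation $\sigma$ of $(0,\dots,m-1)$ with $|x-x_{\sigma_0}|\le|x-x_{\sigma_1}|\le\dots\le|x-x_{\sigma_{m-1}}|$, $$\big|f(x)-L_{m-1}(x;f)\big|\le C\,\mathcal D_{r-1}(x,X)\,\omega_{m-r}(f^{(r)},\tilde x,I)\le C\,\mathcal D_{r-1}(x,X)\,\omega_{m-r}(f^{(r)},|I|,I),$$ where $\tilde x=|I|\big(|x-x_{\sigma_r}|/|I|\big)^{1/(m-r)}$, $\mathcal D_{r-1}(x,X)=\prod_{\nu=0}^{r-1}|x-x_{\sigma_\nu}|$ (equal to $1$ if $r=0$), and $\omega_k(g,t,[a,b])$ is the $k$th modulus of smoothness, that is, the supremum over $0<u\le t$ and over all $y$ with $y\pm\frac{k}{2}u\in[a,b]$ of $\Big|\sum_{i=0}^k(-1)^i\binom ki g\big(y+(\tfrac k2-i)u\big)\Big|$ (equal to $0$ if $t=0$). -/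

import Mathlib

namespace HermiteInterp

/-- The symmetric difference `Δ^k_u(g, x; [a, b])`, equal to `0` unless both extreme nodes
`x ± (k/2)u` lie in `[a, b]`. -/
noncomputable def centralDiff (k : ℕ) (u : ℝ) (g : ℝ → ℝ) (a b x : ℝ) : ℝ :=
  open Classical in
  if x - (k : ℝ) / 2 * u ∈ Set.Icc a b ∧ x + (k : ℝ) / 2 * u ∈ Set.Icc a b then
    ∑ i ∈ Finset.range (k + 1), (-1 : ℝ) ^ i * (k.choose i : ℝ) * g (x + ((k : ℝ) / 2 - i) * u)
  else 0

/-- The `k`th modulus of smoothness `ω_k(g, t; [a, b])`: the supremum of `|Δ^k_u(g, x; [a, b])|`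
over `0 < u ≤ t` and `x ∈ [a, b]`. The set is bounded when `g` is continuous on `[a, b]`. -/
noncomputable def modulus (k : ℕ) (g : ℝ → ℝ) (t a b : ℝ) : ℝ :=
  sSup {y : ℝ | ∃ u x : ℝ, 0 < u ∧ u ≤ t ∧ x ∈ Set.Icc a b ∧ y = |centralDiff k u g a b x|}

/-- The Lagrange–Hermite divided difference `[y 0, …, y n; f]` at knots numbered from left to right,
`y 0 ≤ … ≤ y n` (so the knots all coincide iff `y 0 = y n`, and otherwise `y n` is a knot
different from `y 0`). The derivatives of `f` are taken within `I`. -/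
noncomputable def divDiff (f : ℝ → ℝ) (I : Set ℝ) : (n : ℕ) → (Fin (n + 1) → ℝ) → ℝ
  | 0, y => f (y 0)
  | n + 1, y =>
    open Classical in
    if y 0 = y (Fin.last (n + 1)) then
      iteratedDerivWithin (n + 1) f I (y 0) / ((n + 1).factorial : ℝ)
    else
      (divDiff f I n (Fin.tail y) - divDiff f I n (Fin.init y)) / (y (Fin.last (n + 1)) - y 0)

/-- The Hermite polynomial
`∑_{j < m} [X 0, …, X j; f] (x - X 0) ⋯ (x - X (j-1))` of `f` at the points
`X 0 ≤ … ≤ X (m-1)`. -/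
noncomputable def hermitePoly (f : ℝ → ℝ) (I : Set ℝ) {m : ℕ} (X : Fin m → ℝ) : Polynomial ℝ :=
  ∑ j : Fin m,
    Polynomial.C (divDiff f I j (fun i : Fin (j + 1) => X (Fin.castLE j.isLt i))) *
      ∏ i ∈ Finset.univ.filter (fun i : Fin m => i < j), (Polynomial.X - Polynomial.C (X i))

/-- The number of indices `i < j` with `X i = X j`. -/
noncomputable def repIndex {m : ℕ} (X : Fin m → ℝ) (j : Fin m) : ℕ :=
  open Classical in (Finset.univ.filter (fun i : Fin m => i < j ∧ X i = X j)).card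

/-- `L` has degree at most `m - 1` and interpolates `f` in the sense of Hermite at the `m` points
`X j`: a point that occurs `μ` times matches the derivatives of orders `0, …, μ - 1`. -/
def IsHermiteInterpolant (f : ℝ → ℝ) (I : Set ℝ) {m : ℕ} (X : Fin m → ℝ)
    (L : Polynomial ℝ) : Prop :=
  L.degree < (m : WithBot ℕ) ∧
    ∀ j : Fin m, (Polynomial.derivative^[repIndex X j] L).eval (X j) =
      iteratedDerivWithin (repIndex X j) f I (X j)

/-- `σ` renumbers the points `X j` so that their distance from `x` is nondecreasing. -/
def IsNearestOrder {m : ℕ} (X : Fin m → ℝ) (x : ℝ) (σ : Equiv.Perm (Fin m)) : Prop :=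
  ∀ μ ν : Fin m, μ ≤ ν → |x - X (σ μ)| ≤ |x - X (σ ν)|

/-- The product `∏_{ν < n} |x - X (σ ν)|` of the `n` smallest distances from `x` to the points of
`X`, where `σ` orders the points by distance from `x`. Thus `𝒟_{r-1}(x, X)` is the case `n = r`,
and it is the empty product `1` for `r = 0`. -/
noncomputable def nearProd {m : ℕ} (X : Fin m → ℝ) (x : ℝ) (σ : Equiv.Perm (Fin m)) (n : ℕ) : ℝ :=
  ∏ ν ∈ Finset.univ.filter (fun ν : Fin m => (ν : ℕ) < n), |x - X (σ ν)|

end HermiteInterp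

namespace HermiteInterp

open Polynomial

/-! Write ω for the modulus of `f^(r)` at step h = x̃, and d for the distance |x - x_{σ_r}|, so that
h^(m-r) = |I|^(m-r-1) d. The proof splits f = f₁ + f₂, where f₂ has m derivatives, |f₁^(r)| ≤ ω and
|f₂^(m)| ≤ c h^(-(m-r)) ω on I. Here f₂ is an r-fold antiderivative of a Steklov-type average of
`f^(r)` (`exists_smooth_approx`, `exists_antideriv`). Interpolation is linear, so the two errors can
be estimated separately.

The interpolant of f₁ is stable: its rth derivative is at most a constant times ω
(`abs_eval_iterate_derivative_modByMonic_le`). Divided differences of order r are controlled by the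
mean value theorem, and those of higher order by division by knot gaps of length at least λ|I|. The
error of f₁ vanishes at the r chosen nodes and has a bounded rth derivative, hence is at most a
constant times 𝒟_{r-1} ω.

The error of f₂ vanishes at all m nodes, hence is at most sup |f₂^(m)| times the product of all m
distances. That product is at most 𝒟_{r-1} d |I|^(m-r-1) = 𝒟_{r-1} h^(m-r), which cancels the
negative power of h. Both error bounds are `IsDerivChain.abs_le_mul_prod`, a consequence of Rolle's
theorem with multiplicities.

Algebraically, the Hermite interpolant is the remainder modulo the node polynomial of any polynomial
with the same data, so confluent nodes need no separate treatment. -/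

/-! ### Hermite interpolation as a remainder modulo the node polynomial -/

/-- The monic polynomial whose roots are the `n` consecutive nodes `x s, …, x (s + n - 1)`. -/
noncomputable def nodePoly (x : ℕ → ℝ) (s n : ℕ) : ℝ[X] :=
  ∏ l ∈ Finset.range n, (X - C (x (s + l)))

/-- The leading coefficient of the Hermite interpolant of `P` at `x s, …, x (s + n)`. -/
noncomputable def newtonCoeff (x : ℕ → ℝ) (P : ℝ[X]) (s n : ℕ) : ℝ :=
  (P %ₘ nodePoly x s (n + 1)).coeff n

theorem nodePoly_monic (x : ℕ → ℝ) (s n : ℕ) : (nodePoly x s n).Monic :=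
  monic_prod_of_monic _ _ fun _ _ => monic_X_sub_C _

theorem nodePoly_natDegree (x : ℕ → ℝ) (s n : ℕ) : (nodePoly x s n).natDegree = n := by
  rw [nodePoly, natDegree_prod_of_monic _ _ fun _ _ => monic_X_sub_C _]
  simp

theorem nodePoly_degree (x : ℕ → ℝ) (s n : ℕ) : (nodePoly x s n).degree = n := by
  rw [degree_eq_natDegree (nodePoly_monic x s n).ne_zero, nodePoly_natDegree]

theorem nodePoly_succ (x : ℕ → ℝ) (s n : ℕ) :
    nodePoly x s (n + 1) = nodePoly x s n * (X - C (x (s + n))) := by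
  rw [nodePoly, Finset.prod_range_succ, nodePoly]

theorem nodePoly_succ' (x : ℕ → ℝ) (s n : ℕ) :
    nodePoly x s (n + 1) = (X - C (x s)) * nodePoly x (s + 1) n := by
  rw [nodePoly, Finset.prod_range_succ', nodePoly, mul_comm]
  congr 1
  exact Finset.prod_congr rfl fun l _ => by rw [show s + (l + 1) = s + 1 + l by omega]

theorem degree_modByMonic_nodePoly_lt (x : ℕ → ℝ) (P : ℝ[X]) (s n : ℕ) :
    (P %ₘ nodePoly x s n).degree < n := by
  have h := degree_modByMonic_lt P (nodePoly_monic x s n)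
  rwa [nodePoly_degree] at h

theorem coeff_modByMonic_nodePoly (x : ℕ → ℝ) (P : ℝ[X]) (s : ℕ) {n k : ℕ} (h : n ≤ k) :
    (P %ₘ nodePoly x s n).coeff k = 0 :=
  coeff_eq_zero_of_degree_lt
    ((degree_modByMonic_nodePoly_lt x P s n).trans_le (by exact_mod_cast h))

/-- Neville's scheme. The right side is congruent to `P` modulo the larger node polynomial and its
degree is small enough, so uniqueness of the remainder identifies it. Comparing leading coefficients
gives the divided difference recursion. -/
theorem modByMonic_nodePoly_neville (x : ℕ → ℝ) (P : ℝ[X]) (s n : ℕ)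
    (h : x s ≠ x (s + (n + 1))) :
    P %ₘ nodePoly x s (n + 2) = C (x (s + (n + 1)) - x s)⁻¹ *
      ((P %ₘ nodePoly x (s + 1) (n + 1)) * (X - C (x s)) -
        (P %ₘ nodePoly x s (n + 1)) * (X - C (x (s + (n + 1))))) := by
  refine (div_modByMonic_unique (C (x (s + (n + 1)) - x s)⁻¹ *
    (P /ₘ nodePoly x (s + 1) (n + 1) - P /ₘ nodePoly x s (n + 1))) _
    (nodePoly_monic x s (n + 2)) ⟨?_, ?_⟩).2
  · have hA := modByMonic_add_div P (nodePoly x (s + 1) (n + 1))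
    have hB := modByMonic_add_div P (nodePoly x s (n + 1))
    have hW := nodePoly_succ x s (n + 1)
    have hW' := nodePoly_succ' x s (n + 1)
    have hd : C (x (s + (n + 1)) - x s)⁻¹ * (C (x (s + (n + 1))) - C (x s)) = (1 : ℝ[X]) := by
      rw [← C_sub, ← C_mul, inv_mul_cancel₀ (sub_ne_zero.2 (Ne.symm h)), C_1]
    set A := P %ₘ nodePoly x (s + 1) (n + 1)
    set B := P %ₘ nodePoly x s (n + 1)
    set qA := P /ₘ nodePoly x (s + 1) (n + 1)
    set qB := P /ₘ nodePoly x s (n + 1)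
    set c := C (x (s + (n + 1)) - x s)⁻¹
    linear_combination c * (X - C (x s)) * hA - c * (X - C (x (s + (n + 1)))) * hB + P * hd
      + c * qA * hW' - c * qB * hW
  · rw [nodePoly_degree, degree_lt_iff_coeff_zero]
    intro k hk
    obtain ⟨k, rfl⟩ : ∃ j, k = j + 1 := ⟨k - 1, by omega⟩
    rw [coeff_C_mul, coeff_sub, coeff_mul_X_sub_C, coeff_mul_X_sub_C]
    simp only [coeff_modByMonic_nodePoly x P _ (show n + 1 ≤ k by omega),
      coeff_modByMonic_nodePoly x P _ (show n + 1 ≤ k + 1 by omega)]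
    simp

theorem newtonCoeff_succ (x : ℕ → ℝ) (P : ℝ[X]) (s n : ℕ) (h : x s ≠ x (s + (n + 1))) :
    newtonCoeff x P s (n + 1) =
      (newtonCoeff x P (s + 1) n - newtonCoeff x P s n) / (x (s + (n + 1)) - x s) := by
  rw [newtonCoeff, modByMonic_nodePoly_neville x P s n h, coeff_C_mul, coeff_sub,
    coeff_mul_X_sub_C, coeff_mul_X_sub_C, coeff_modByMonic_nodePoly x P _ le_rfl,
    coeff_modByMonic_nodePoly x P _ le_rfl, newtonCoeff, newtonCoeff]
  ring

theorem modByMonic_nodePoly_succ (x : ℕ → ℝ) (P : ℝ[X]) (s n : ℕ) :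
    P %ₘ nodePoly x s (n + 1) =
      P %ₘ nodePoly x s n + C (newtonCoeff x P s n) * nodePoly x s n := by
  rw [← sub_eq_iff_eq_add]
  symm
  refine (div_modByMonic_unique (C (newtonCoeff x P s n) +
    (X - C (x (s + n))) * (P /ₘ nodePoly x s (n + 1))) _ (nodePoly_monic x s n) ⟨?_, ?_⟩).2
  · have h := modByMonic_add_div P (nodePoly x s (n + 1))
    have hW := nodePoly_succ x s n
    linear_combination h - (P /ₘ nodePoly x s (n + 1)) * hW
  · rw [nodePoly_degree, degree_lt_iff_coeff_zero]
    intro k hk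
    rw [coeff_sub, coeff_C_mul]
    rcases hk.eq_or_lt with rfl | hk
    · have h1 : (nodePoly x s n).coeff n = 1 := by
        have h2 := (nodePoly_monic x s n).coeff_natDegree
        rwa [nodePoly_natDegree] at h2
      rw [h1, newtonCoeff]
      ring
    · rw [coeff_modByMonic_nodePoly x P s hk, coeff_eq_zero_of_natDegree_lt
        (by rwa [nodePoly_natDegree])]
      ring

theorem modByMonic_nodePoly_eq_sum (x : ℕ → ℝ) (P : ℝ[X]) (s n : ℕ) :
    P %ₘ nodePoly x s n =
      ∑ j ∈ Finset.range n, C (newtonCoeff x P s j) * nodePoly x s j := by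
  induction n with
  | zero => simp [nodePoly]
  | succ n ih => rw [modByMonic_nodePoly_succ, ih, Finset.sum_range_succ]

/-! ### Interpolation data with multiplicities -/

theorem eval_iterate_derivative_eq_zero {R : ℝ[X]} {c : ℝ} {n s : ℕ} (h : (X - C c) ^ n ∣ R)
    (hs : s < n) : (derivative^[s] R).eval c = 0 := by
  obtain ⟨Q, hQ⟩ := pow_sub_dvd_iterate_derivative_of_pow_dvd s h
  rw [hQ]
  simp [show n - s ≠ 0 by omega]

theorem iterate_derivative_eq_C {R : ℝ[X]} {n : ℕ} (h : ∀ k, n < k → R.coeff k = 0) :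
    derivative^[n] R = C (n.factorial * R.coeff n) := by
  ext k
  rw [coeff_iterate_derivative, coeff_C]
  rcases Nat.eq_zero_or_pos k with rfl | hk
  · simp [Nat.descFactorial_self]
  · rw [h _ (by omega), if_neg (by omega), smul_zero]

/-- If `∏ c ∈ S, (X - c)` divides `R`, then `R` vanishes on `S` with multiplicities. -/
theorem eval_iterate_derivative_of_prod_dvd {R : ℝ[X]} {S : Multiset ℝ}
    (h : (S.map fun c => X - C c).prod ∣ R) {c : ℝ} {s : ℕ} (hs : s < S.count c) :
    (derivative^[s] R).eval c = 0 := by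
  refine eval_iterate_derivative_eq_zero (n := S.count c) (Dvd.dvd.trans ?_ h) hs
  rw [← Multiset.prod_replicate, ← Multiset.map_replicate (fun c => X - C c)]
  exact Multiset.prod_dvd_prod_of_le (Multiset.map_le_map (Multiset.le_count_iff_replicate_le.1 le_rfl))

/-- The nodes `x s, …, x (s + n - 1)` as a multiset. -/
noncomputable def nodeMultiset (x : ℕ → ℝ) (s n : ℕ) : Multiset ℝ :=
  (Finset.Ico s (s + n)).val.map x

theorem nodeMultiset_prod (x : ℕ → ℝ) (s n : ℕ) :
    ((nodeMultiset x s n).map fun c => X - C c).prod = nodePoly x s n := by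
  rw [nodeMultiset, Multiset.map_map, nodePoly]
  change ∏ k ∈ Finset.Ico s (s + n), (X - C (x k)) = _
  rw [Finset.prod_Ico_eq_prod_range, Nat.add_sub_cancel_left]

theorem nodeMultiset_mono (x : ℕ → ℝ) {s n t k : ℕ} (h : s ≤ t) (h' : t + k ≤ s + n) :
    nodeMultiset x t k ≤ nodeMultiset x s n :=
  Multiset.map_le_map (Finset.val_le_iff.2 (Finset.Ico_subset_Ico h h'))

theorem lt_count_nodeMultiset {x : ℕ → ℝ} (hx : Monotone x) {s n i j : ℕ} (hi : s ≤ i)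
    (hj : i + j < s + n) (h : x i = x (i + j)) : j < (nodeMultiset x s n).count (x i) := by
  refine lt_of_lt_of_le ?_ (Multiset.count_le_of_le _ (nodeMultiset_mono x (k := j + 1) hi (by omega)))
  have : nodeMultiset x i (j + 1) = Multiset.replicate (j + 1) (x i) := by
    rw [Multiset.eq_replicate]
    refine ⟨by simp [nodeMultiset], fun b hb => ?_⟩
    simp only [nodeMultiset, Multiset.mem_map, Finset.mem_val, Finset.mem_Ico] at hb
    obtain ⟨l, hl, rfl⟩ := hb
    exact le_antisymm ((hx (by omega)).trans h.ge) (hx hl.1)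
  rw [this, Multiset.count_replicate_self]
  omega

/-- `P` matches the data `D s c` of order `s` at every `c ∈ S`, below the multiplicity of `c`. -/
def Interpolates (P : ℝ[X]) (D : ℕ → ℝ → ℝ) (S : Multiset ℝ) : Prop :=
  ∀ c s, s < S.count c → (derivative^[s] P).eval c = D s c

theorem Interpolates.mono {P : ℝ[X]} {D : ℕ → ℝ → ℝ} {S T : Multiset ℝ}
    (h : Interpolates P D T) (hST : S ≤ T) : Interpolates P D S :=
  fun c s hs => h c s (hs.trans_le (Multiset.count_le_of_le _ hST))

theorem Interpolates.sub {P Q : ℝ[X]} {D E : ℕ → ℝ → ℝ} {S : Multiset ℝ}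
    (hP : Interpolates P D S) (hQ : Interpolates Q E S) :
    Interpolates (P - Q) (fun s c => D s c - E s c) S := fun c s hs => by
  rw [iterate_derivative_sub, eval_sub, hP c s hs, hQ c s hs]

theorem Interpolates.modByMonic {P : ℝ[X]} {D : ℕ → ℝ → ℝ} {x : ℕ → ℝ} {s n : ℕ}
    (h : Interpolates P D (nodeMultiset x s n)) :
    Interpolates (P %ₘ nodePoly x s n) D (nodeMultiset x s n) := fun c j hj => by
  have h1 : (derivative^[j] (P - P %ₘ nodePoly x s n)).eval c = 0 := by
    refine eval_iterate_derivative_of_prod_dvd (S := nodeMultiset x s n) ?_ hj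
    rw [nodeMultiset_prod]
    exact ⟨P /ₘ nodePoly x s n, by
      linear_combination -modByMonic_add_div P (nodePoly x s n)⟩
  rw [iterate_derivative_sub, eval_sub, sub_eq_zero] at h1
  rw [← h1, h c j hj]

/-- Chinese remainder theorem for the pairwise coprime powers (X - c)^n. Applied to Taylor
polynomials at the nodes, it replaces arbitrary Hermite data by those of a polynomial. -/
theorem exists_polynomial_forall_dvd_sub (T : Finset ℝ) (n : ℕ) (Q : ℝ → ℝ[X]) :
    ∃ F : ℝ[X], ∀ c ∈ T, (X - C c) ^ n ∣ F - Q c := by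
  classical
  induction T using Finset.induction_on with
  | empty => exact ⟨0, by simp⟩
  | insert c T hc ih =>
    obtain ⟨F, hF⟩ := ih
    have hcop : IsCoprime (∏ d ∈ T, (X - C d) ^ n) ((X - C c) ^ n) :=
      IsCoprime.prod_left fun d hd => IsCoprime.pow
        (isCoprime_X_sub_C_of_isUnit_sub
          (sub_ne_zero.2 (by rintro rfl; exact hc hd)).isUnit)
    obtain ⟨u, v, huv⟩ := hcop
    refine ⟨F + (∏ d ∈ T, (X - C d) ^ n) * (u * (Q c - F)), fun d hd => ?_⟩
    rcases Finset.mem_insert.1 hd with rfl | hd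
    · exact ⟨-(v * (Q d - F)), by linear_combination (Q d - F) * huv⟩
    · rw [add_sub_right_comm]
      exact dvd_add (hF d hd) (Dvd.dvd.mul_right
        (Finset.dvd_prod_of_mem (fun d => (X - C d) ^ n) hd) _)

theorem exists_polynomial_iterate_derivative_eq (T : Finset ℝ) (n : ℕ) (D : ℕ → ℝ → ℝ) :
    ∃ F : ℝ[X], ∀ c ∈ T, ∀ s < n, (derivative^[s] F).eval c = D s c := by
  obtain ⟨F, hF⟩ := exists_polynomial_forall_dvd_sub T n fun c =>
    ∑ j ∈ Finset.range n, C (D j c / j.factorial) * (X - C c) ^ j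
  refine ⟨F, fun c hc s hs => ?_⟩
  have h := eval_iterate_derivative_eq_zero (hF c hc) hs
  rw [iterate_derivative_sub, eval_sub, sub_eq_zero] at h
  rw [h, iterate_derivative_sum, eval_finsetSum, Finset.sum_eq_single_of_mem s (by simpa using hs)]
  · rw [iterate_derivative_C_mul, iterate_derivative_X_sub_pow]
    simp [Nat.descFactorial_self, Nat.factorial_ne_zero]
  · intro j _ hj
    rw [iterate_derivative_C_mul, iterate_derivative_X_sub_pow]
    rcases lt_or_gt_of_ne hj with hj | hj
    · simp [Nat.descFactorial_of_lt hj]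
    · simp [show j - s ≠ 0 by omega]

theorem exists_interpolates (S : Multiset ℝ) (D : ℕ → ℝ → ℝ) :
    ∃ F : ℝ[X], Interpolates F D S := by
  classical
  obtain ⟨F, hF⟩ := exists_polynomial_iterate_derivative_eq S.toFinset S.card D
  refine ⟨F, fun c s hs => hF c ?_ s (hs.trans_le (Multiset.count_le_card _ _))⟩
  rw [Multiset.mem_toFinset, ← Multiset.count_pos]
  omega

/-! ### Divided differences as Newton coefficients -/

/-- Both sides obey the same recursion. For distinct end knots this is Neville's scheme; if all
knots coincide, the remainder has degree at most `n`, so its `n`th derivative is the constant n!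
times its top coefficient. -/
theorem divDiff_eq_newtonCoeff {f : ℝ → ℝ} {I : Set ℝ} {x : ℕ → ℝ} (hx : Monotone x) {P : ℝ[X]}
    (n s : ℕ) (h : Interpolates P (fun j => iteratedDerivWithin j f I)
      (nodeMultiset x s (n + 1))) :
    divDiff f I n (fun i : Fin (n + 1) => x (s + i)) = newtonCoeff x P s n := by
  induction n generalizing s with
  | zero =>
    have h0 := h (x s) 0 (lt_count_nodeMultiset hx le_rfl (by omega) rfl)
    simp only [Function.iterate_zero, id_eq, iteratedDerivWithin_zero] at h0
    rw [divDiff, newtonCoeff]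
    simp [nodePoly, modByMonic_X_sub_C_eq_C_eval, h0]
  | succ n ih =>
    rw [divDiff]
    simp only [Fin.val_zero, Fin.val_last, add_zero]
    split_ifs with heq
    · have h1 := h (x s) (n + 1) (lt_count_nodeMultiset hx le_rfl (by omega) heq)
      have h2 := h.modByMonic (x s) (n + 1) (lt_count_nodeMultiset hx le_rfl (by omega) heq)
      rw [iterate_derivative_eq_C fun k hk => coeff_modByMonic_nodePoly x P s hk, eval_C] at h2
      rw [← h2, newtonCoeff]
      field_simp
    · have hle1 := nodeMultiset_mono x (s := s) (n := n + 1 + 1) (t := s + 1) (k := n + 1) (by omega)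
        (by omega)
      have hle2 := nodeMultiset_mono x (s := s) (n := n + 1 + 1) (t := s) (k := n + 1) le_rfl
        (by omega)
      rw [newtonCoeff_succ x P s n heq, ← ih (s + 1) (h.mono hle1), ← ih s (h.mono hle2)]
      congr 2
      congr 1
      ext i
      simp [Fin.tail]
      congr 1
      omega

/-! ### Rolle's theorem with multiplicities and its consequences -/

/-- `D 0, …, D n` are successive derivatives on `[a, b]`. -/
def IsDerivChain (n : ℕ) (D : ℕ → ℝ → ℝ) (a b : ℝ) : Prop :=
  ∀ i < n, ∀ x ∈ Set.Icc a b, HasDerivWithinAt (D i) (D (i + 1) x) (Set.Icc a b) x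

theorem IsDerivChain.sub {n : ℕ} {D E : ℕ → ℝ → ℝ} {a b : ℝ} (hD : IsDerivChain n D a b)
    (hE : IsDerivChain n E a b) : IsDerivChain n (fun i x => D i x - E i x) a b :=
  fun i hi x hx => (hD i hi x hx).sub (hE i hi x hx)

theorem IsDerivChain.mono {n k : ℕ} {D : ℕ → ℝ → ℝ} {a b : ℝ} (hD : IsDerivChain n D a b)
    (h : k ≤ n) : IsDerivChain k D a b :=
  fun i hi => hD i (hi.trans_le h)

theorem isDerivChain_polynomial (P : ℝ[X]) (n : ℕ) (a b : ℝ) :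
    IsDerivChain n (fun i x => (derivative^[i] P).eval x) a b := fun i _ x _ => by
  simp only [Function.iterate_succ_apply']
  exact (Polynomial.hasDerivAt _ x).hasDerivWithinAt

/-- Rolle's theorem for `n + 1` zeros counted with multiplicities. -/
theorem IsDerivChain.exists_eq_zero {a b : ℝ} (n : ℕ) {D : ℕ → ℝ → ℝ}
    (hD : IsDerivChain n D a b) {y : ℕ → ℝ} (hy : Monotone y) (hab : ∀ i, y i ∈ Set.Icc a b)
    (h0 : ∀ i s, i + s ≤ n → y i = y (i + s) → D s (y i) = 0) :
    ∃ ξ ∈ Set.Icc a b, D n ξ = 0 := by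
  induction n generalizing D y with
  | zero => exact ⟨y 0, hab 0, h0 0 0 le_rfl rfl⟩
  | succ n ih =>
    -- The zeros of the derivative are a repeated node itself, or an interior Rolle point of a
    -- proper gap. Beyond index `n` only the interlacing matters, and `y i` is a filler.
    have key : ∀ i, ∃ z, y i ≤ z ∧ z ≤ y (i + 1) ∧ (i ≤ n → D 1 z = 0) ∧
        (i ≤ n → y i = y (i + 1) ∨ y i < z ∧ z < y (i + 1)) := by
      intro i
      rcases (hy (Nat.le_succ i)).eq_or_lt with heq | hlt
      · exact ⟨y i, le_rfl, heq.le, fun hi => h0 i 1 (by omega) heq, fun _ => Or.inl heq⟩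
      · by_cases hi : i ≤ n
        · have hsub : Set.Icc (y i) (y (i + 1)) ⊆ Set.Icc a b :=
            Set.Icc_subset_Icc (hab i).1 (hab (i + 1)).2
          obtain ⟨z, hz, hz0⟩ := exists_hasDerivAt_eq_zero (f := D 0) (f' := D 1) hlt
            (fun x hx => ((hD 0 (by omega) x (hsub hx)).continuousWithinAt).mono hsub)
            (by rw [h0 i 0 (by omega) rfl, h0 (i + 1) 0 (by omega) rfl])
            (fun x hx => (hD 0 (by omega) x (hsub ⟨hx.1.le, hx.2.le⟩)).hasDerivAt
              (Icc_mem_nhds ((hab i).1.trans_lt hx.1) (hx.2.trans_le (hab (i + 1)).2)))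
          exact ⟨z, hz.1.le, hz.2.le, fun _ => hz0, fun _ => Or.inr hz⟩
        · exact ⟨y i, le_rfl, hlt.le, fun h => absurd h hi, fun h => absurd h hi⟩
    choose z hz1 hz2 hz0 hz using key
    have hzm : Monotone z := monotone_nat_of_le_succ fun i => (hz2 i).trans (hz1 (i + 1))
    refine ih (D := fun i => D (i + 1)) (fun i hi => hD (i + 1) (by omega)) hzm
      (fun i => ⟨(hab i).1.trans (hz1 i), (hz2 i).trans (hab (i + 1)).2⟩) ?_
    intro i s his hzs
    rcases Nat.eq_zero_or_pos s with rfl | hs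
    · exact hz0 i (by omega)
    -- An interior Rolle point is never repeated, since the next zeros lie beyond the right end of
    -- its gap. So equality of `z i` and `z (i + s)` forces `s + 2` equal nodes, and the hypothesis
    -- applies one order higher.
    · have e1 : y (i + 1) ≤ y (i + s) := hy (by omega)
      have e2 := hz2 i
      have e3 := hz1 (i + s)
      have e4 : y i = y (i + 1) := by
        rcases hz i (by omega) with h | h
        · exact h
        · linarith [h.2]
      have e5 : y (i + s) = y (i + (s + 1)) := by
        rcases hz (i + s) (by omega) with h | h
        · exact h
        · linarith [h.1]
      have e6 := hz1 i
      rw [show z i = y i by linarith]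
      exact h0 i (s + 1) (by omega) (by linarith)

theorem IsDerivChain.exists_eq_zero_of_multiset {a b : ℝ} {n : ℕ} {D : ℕ → ℝ → ℝ}
    (hD : IsDerivChain n D a b) {S : Multiset ℝ} (hS : S.card = n + 1)
    (hab : ∀ c ∈ S, c ∈ Set.Icc a b) (h0 : ∀ c s, s < S.count c → D s c = 0) :
    ∃ ξ ∈ Set.Icc a b, D n ξ = 0 := by
  set l := S.sort (· ≤ ·) with hl
  have hlen : l.length = n + 1 := by rw [hl, Multiset.length_sort, hS]
  have hsort : l.SortedLE := (Multiset.pairwise_sort S (· ≤ ·)).sortedLE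
  have hlS : (l : Multiset ℝ) = S := Multiset.sort_eq S (· ≤ ·)
  have hmono : Monotone fun i : ℕ => l[min i n]'(by omega) := fun i j hij =>
    hsort.monotone_get (a := ⟨min i n, by omega⟩) (b := ⟨min j n, by omega⟩)
      (Fin.mk_le_mk.2 (by omega))
  refine hD.exists_eq_zero n hmono (fun i => hab _ ?_) fun i s his heq => h0 _ _ ?_
  · exact (Multiset.mem_sort (· ≤ ·)).1 (List.getElem_mem (l := l) _)
  · set c := l[min i n]'(by omega) with hc
    have hsub : ((l.drop i).take (s + 1)).Sublist l :=
      (List.take_sublist _ _).trans (List.drop_sublist _ _)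
    have hrep : (l.drop i).take (s + 1) = List.replicate (s + 1) c := by
      rw [List.eq_replicate_iff]
      refine ⟨by simp; omega, fun d hd => ?_⟩
      obtain ⟨k, hk, rfl⟩ := List.getElem_of_mem hd
      have hk' : k < s + 1 := by simp at hk; omega
      have h1 := hmono (show i ≤ i + k by omega)
      have h2 := hmono (show i + k ≤ i + s by omega)
      simp only [List.getElem_take, List.getElem_drop]
      simp only [show min (i + k) n = i + k by omega] at h1 h2
      exact le_antisymm (h2.trans heq.ge) h1
    have h3 := hsub.count_le c
    rw [hrep, List.count_replicate_self] at h3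
    rw [← hlS, Multiset.coe_count]
    omega

/-- Mean value theorem for divided differences: Rolle applied to the function minus its interpolant,
whose `n`th derivative is constant. -/
theorem IsDerivChain.exists_eq_factorial_mul_newtonCoeff {a b : ℝ} {x : ℕ → ℝ} (hx : Monotone x)
    (hab : ∀ i, x i ∈ Set.Icc a b) {n s : ℕ} {D : ℕ → ℝ → ℝ} (hD : IsDerivChain n D a b)
    {P : ℝ[X]} (hP : Interpolates P D (nodeMultiset x s (n + 1))) :
    ∃ ξ ∈ Set.Icc a b, D n ξ = n.factorial * newtonCoeff x P s n := by
  obtain ⟨ξ, hξ, h⟩ := (hD.sub (isDerivChain_polynomial (P %ₘ nodePoly x s (n + 1)) n a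
    b)).exists_eq_zero n (y := fun i => x (s + i))
      (fun i j hij => hx (by omega)) (fun i => hab _) (fun i t hit heq => by
        have := hP.modByMonic (x (s + i)) t (lt_count_nodeMultiset hx (by omega) (by omega)
          (by rw [heq, add_assoc]))
        simp only [this, sub_self])
  refine ⟨ξ, hξ, ?_⟩
  rw [iterate_derivative_eq_C fun k hk => coeff_modByMonic_nodePoly x P s hk, eval_C,
    sub_eq_zero] at h
  exact h

/-- A function that vanishes on `S`, with multiplicities, is at most the product of the distances
to `S` times a bound for its derivative of order `card S`. -/
theorem IsDerivChain.abs_le_mul_prod {a b : ℝ} {n : ℕ} {D : ℕ → ℝ → ℝ}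
    (hD : IsDerivChain n D a b) {S : Multiset ℝ} (hS : S.card = n)
    (hab : ∀ c ∈ S, c ∈ Set.Icc a b) (h0 : ∀ c s, s < S.count c → D s c = 0)
    {x : ℝ} (hx : x ∈ Set.Icc a b) {M : ℝ} (hM : ∀ t ∈ Set.Icc a b, |D n t| ≤ M) :
    |D 0 x| ≤ M * (S.map fun c => |x - c|).prod := by
  have hM0 : 0 ≤ M := (abs_nonneg _).trans (hM x hx)
  by_cases hxS : x ∈ S
  · rw [h0 x 0 (Multiset.count_pos.2 hxS), abs_zero]
    refine mul_nonneg hM0 (Multiset.prod_nonneg fun y hy => ?_)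
    obtain ⟨c, -, rfl⟩ := Multiset.mem_map.1 hy
    exact abs_nonneg _
  set W : ℝ[X] := (S.map fun c => X - C c).prod with hW
  have hWm : W.Monic := monic_multiset_prod_of_monic _ _ fun c _ => monic_X_sub_C c
  have hWd : W.natDegree = n := by rw [hW, natDegree_multiset_prod_X_sub_C_eq_card, hS]
  have hWx : W.eval x ≠ 0 := by
    rw [hW, eval_multiset_prod, Multiset.map_map]
    refine Multiset.prod_ne_zero fun h => hxS ?_
    obtain ⟨c, hc, hc0⟩ := Multiset.mem_map.1 h
    have : x = c := by simpa [sub_eq_zero] using hc0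
    rwa [this]
  have habs : (S.map fun c => |x - c|).prod = |W.eval x| := by
    rw [hW, eval_multiset_prod, Multiset.map_map]
    have h := map_multiset_prod (absHom : ℝ →*₀ ℝ) (S.map (eval x ∘ fun c => X - C c))
    rw [Multiset.map_map] at h
    refine Eq.trans ?_ h.symm
    congr 1
    refine Multiset.map_congr rfl fun c _ => ?_
    simp [absHom]
  -- With this multiple of `W` subtracted, `x` becomes a further zero, and Rolle gives D n ξ = n! q.
  -- The factor 1/n! is then discarded.
  set q := D 0 x / W.eval x with hq
  obtain ⟨ξ, hξ, h⟩ := (hD.sub (isDerivChain_polynomial (C q * W) n a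
    b)).exists_eq_zero_of_multiset (S := x ::ₘ S) (by rw [Multiset.card_cons, hS])
      (fun c hc => by
        rcases Multiset.mem_cons.1 hc with rfl | hc
        exacts [hx, hab c hc]) (fun c s hs => by
        by_cases hcx : c = x
        · subst hcx
          rw [Multiset.count_cons_self, Multiset.count_eq_zero_of_notMem hxS] at hs
          obtain rfl : s = 0 := by omega
          simp only [Function.iterate_zero, id_eq, eval_mul, eval_C, hq]
          field_simp
          ring
        · rw [Multiset.count_cons_of_ne hcx] at hs
          rw [h0 c s hs, iterate_derivative_C_mul, eval_mul,
            eval_iterate_derivative_of_prod_dvd (dvd_refl W) hs]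
          simp)
  have hWn : W.coeff n = 1 := by rw [← hWd]; exact hWm.coeff_natDegree
  rw [iterate_derivative_C_mul, iterate_derivative_eq_C (n := n) (R := W) fun k hk =>
    coeff_eq_zero_of_natDegree_lt (by rwa [hWd]), hWn] at h
  simp only [eval_mul, eval_C, mul_one] at h
  have hqM : |q| ≤ M := by
    have h1 := hM ξ hξ
    rw [sub_eq_zero.1 h, abs_mul, Nat.abs_cast] at h1
    refine le_trans (le_mul_of_one_le_right (abs_nonneg _) ?_) h1
    exact_mod_cast Nat.one_le_iff_ne_zero.2 (Nat.factorial_ne_zero n)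
  rw [habs, show D 0 x = q * W.eval x by rw [hq]; field_simp, abs_mul]
  exact mul_le_mul_of_nonneg_right hqM (abs_nonneg _)

/-! ### Iterated averages and their derivatives -/

/-- The average of `g` over the segment from `y` to `y + η`. -/
noncomputable def avg (η : ℝ) (g : ℝ → ℝ) (y : ℝ) : ℝ :=
  ∫ t in (0 : ℝ)..1, g (y + η * t)

theorem continuous_avg (η : ℝ) {g : ℝ → ℝ} (hg : Continuous g) : Continuous (avg η g) :=
  intervalIntegral.continuous_parametric_intervalIntegral_of_continuous'
    (f := fun y t => g (y + η * t)) (by fun_prop) 0 1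

theorem continuous_avg_iterate (η : ℝ) {g : ℝ → ℝ} (hg : Continuous g) (k : ℕ) :
    Continuous ((avg η)^[k] g) := by
  induction k with
  | zero => exact hg
  | succ k ih => rw [Function.iterate_succ_apply']; exact continuous_avg η ih

/-- The average is a difference quotient of a primitive. Each averaging therefore gains one
derivative, at the price of a forward difference divided by `η`. -/
theorem hasDerivAt_avg {η : ℝ} (hη : η ≠ 0) {g : ℝ → ℝ} (hg : Continuous g) (y : ℝ) :
    HasDerivAt (avg η g) (η⁻¹ * fwdDiff η g y) y := by
  have h1 : avg η g = fun y => η⁻¹ * ((∫ v in (0 : ℝ)..(y + η), g v) - ∫ v in (0 : ℝ)..y, g v) := by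
    ext y
    rw [avg, intervalIntegral.integral_comp_add_mul _ hη, smul_eq_mul, mul_zero, add_zero, mul_one,
      intervalIntegral.integral_interval_sub_left (hg.intervalIntegrable _ _)
        (hg.intervalIntegrable _ _)]
  have hF : ∀ z, HasDerivAt (fun z => ∫ v in (0 : ℝ)..z, g v) (g z) z := fun z =>
    intervalIntegral.integral_hasDerivAt_right (hg.intervalIntegrable _ _)
      (hg.stronglyMeasurableAtFilter _ _) hg.continuousAt
  rw [h1, fwdDiff]
  exact (((hF (y + η)).comp_add_const y η).sub (hF y)).const_mul _

theorem fwdDiff_avg (η : ℝ) {g : ℝ → ℝ} (hg : Continuous g) :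
    fwdDiff η (avg η g) = avg η (fwdDiff η g) := by
  ext y
  simp only [fwdDiff, avg]
  rw [← intervalIntegral.integral_sub
    (Continuous.intervalIntegrable (by fun_prop) _ _)
    (Continuous.intervalIntegrable (by fun_prop) _ _)]
  congr 1
  ext t
  rw [add_right_comm]

theorem fwdDiff_avg_iterate (η : ℝ) {g : ℝ → ℝ} (hg : Continuous g) (k : ℕ) :
    fwdDiff η ((avg η)^[k] g) = (avg η)^[k] (fwdDiff η g) := by
  induction k with
  | zero => rfl
  | succ k ih =>
    rw [Function.iterate_succ_apply', fwdDiff_avg η (continuous_avg_iterate η hg k), ih,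
      Function.iterate_succ_apply']

theorem continuous_fwdDiff_iterate (η : ℝ) {g : ℝ → ℝ} (hg : Continuous g) (k : ℕ) :
    Continuous ((fwdDiff η)^[k] g) := by
  induction k with
  | zero => exact hg
  | succ k ih =>
    rw [Function.iterate_succ_apply']
    exact (ih.comp (continuous_id.add continuous_const)).sub ih

/-- The `i`th derivative of the `k`-fold average of `g`. -/
noncomputable def steklovDeriv (k : ℕ) (η : ℝ) (g : ℝ → ℝ) (i : ℕ) (y : ℝ) : ℝ :=
  η⁻¹ ^ i * (avg η)^[k - i] ((fwdDiff η)^[i] g) y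

theorem hasDerivAt_steklovDeriv {k : ℕ} {η : ℝ} (hη : η ≠ 0) {g : ℝ → ℝ} (hg : Continuous g)
    {i : ℕ} (hi : i < k) (y : ℝ) :
    HasDerivAt (steklovDeriv k η g i) (steklovDeriv k η g (i + 1) y) y := by
  have hc := continuous_fwdDiff_iterate η hg i
  have h := (hasDerivAt_avg hη (continuous_avg_iterate η hc (k - (i + 1))) y).const_mul (η⁻¹ ^ i)
  rw [fwdDiff_avg_iterate η hc, ← Function.iterate_succ_apply' (fwdDiff η),
    ← Function.iterate_succ_apply' (avg η), ← mul_assoc, ← pow_succ,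
    show (k - (i + 1)).succ = k - i by omega] at h
  exact h

/-- Rescaling to unit step allows averages of different steps `η` to be gathered under one average
in the same variable. -/
theorem avg_iterate_comp (η : ℝ) (g : ℝ → ℝ) (y : ℝ) (k : ℕ) :
    (avg 1)^[k] (fun s => g (y + η * s)) = fun s => (avg η)^[k] g (y + η * s) := by
  induction k with
  | zero => rfl
  | succ k ih =>
    rw [Function.iterate_succ_apply', ih]
    ext s
    rw [Function.iterate_succ_apply', avg, avg]
    congr 1
    ext t
    ring_nf

theorem avg_iterate_sum {ι : Type*} (T : Finset ι) (c : ι → ℝ) {Φ : ι → ℝ → ℝ}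
    (hΦ : ∀ i, Continuous (Φ i)) (k : ℕ) :
    (avg 1)^[k] (fun s => ∑ i ∈ T, c i * Φ i s) =
      fun s => ∑ i ∈ T, c i * (avg 1)^[k] (Φ i) s := by
  induction k with
  | zero => rfl
  | succ k ih =>
    rw [Function.iterate_succ_apply', ih]
    ext s
    rw [avg, intervalIntegral.integral_finsetSum]
    · refine Finset.sum_congr rfl fun i _ => ?_
      rw [intervalIntegral.integral_const_mul, Function.iterate_succ_apply', avg]
    · intro i _
      have := continuous_avg_iterate 1 (hΦ i) k
      exact Continuous.intervalIntegrable (by fun_prop) _ _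

theorem abs_avg_iterate_le {Φ : ℝ → ℝ} {M : ℝ} (k : ℕ) (s : ℝ)
    (h : ∀ t ∈ Set.Icc s (s + k), |Φ t| ≤ M) : |(avg 1)^[k] Φ s| ≤ M := by
  induction k generalizing s with
  | zero => exact h s (by simp)
  | succ k ih =>
    rw [Function.iterate_succ_apply', avg]
    have h1 := intervalIntegral.norm_integral_le_of_norm_le_const (a := (0 : ℝ)) (b := 1) (C := M)
      (f := fun t => (avg 1)^[k] Φ (s + 1 * t)) fun t ht => by
        rw [Set.uIoc_of_le zero_le_one] at ht
        refine ih _ fun v hv => h v ⟨?_, ?_⟩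
        · linarith [hv.1, ht.1]
        · push_cast
          linarith [hv.2, ht.2]
    simpa using h1

/-! ### The modulus of smoothness -/

theorem centralDiff_congr {g G : ℝ → ℝ} {a b : ℝ} (h : Set.EqOn g G (Set.Icc a b)) {k : ℕ} {u : ℝ}
    (hu : 0 ≤ u) (x : ℝ) : centralDiff k u g a b x = centralDiff k u G a b x := by
  rw [centralDiff, centralDiff]
  split_ifs with hx
  · refine Finset.sum_congr rfl fun i hi => ?_
    have hi' : (i : ℝ) ≤ k := by exact_mod_cast Nat.lt_succ_iff.1 (Finset.mem_range.1 hi)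
    rw [h ⟨?_, ?_⟩]
    · have := mul_nonneg (sub_nonneg.2 hi') hu
      linarith [hx.1.1]
    · have := mul_nonneg (Nat.cast_nonneg (α := ℝ) i) hu
      linarith [hx.2.2]
  · rfl

theorem modulus_congr {g G : ℝ → ℝ} {a b : ℝ} (h : Set.EqOn g G (Set.Icc a b)) (k : ℕ) (t : ℝ) :
    modulus k g t a b = modulus k G t a b := by
  unfold modulus
  congr 1
  ext y
  refine exists_congr fun u => exists_congr fun x => and_congr_right fun hu => ?_
  rw [centralDiff_congr h hu.le]

theorem modulus_nonneg (k : ℕ) (g : ℝ → ℝ) (t a b : ℝ) : 0 ≤ modulus k g t a b :=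
  Real.sSup_nonneg fun y hy => by
    obtain ⟨u, x, -, -, -, rfl⟩ := hy
    exact abs_nonneg _

/-- Boundedness makes `sSup` a true supremum instead of its default value 0. -/
theorem bddAbove_modulus {g : ℝ → ℝ} {a b : ℝ} (hg : ContinuousOn g (Set.Icc a b)) (k : ℕ)
    (t : ℝ) : BddAbove {y : ℝ | ∃ u x : ℝ, 0 < u ∧ u ≤ t ∧ x ∈ Set.Icc a b ∧
      y = |centralDiff k u g a b x|} := by
  obtain ⟨B, hB⟩ := isCompact_Icc.exists_bound_of_continuousOn hg
  refine ⟨∑ i ∈ Finset.range (k + 1), (k.choose i : ℝ) * |B|, ?_⟩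
  rintro y ⟨u, x, hu, -, -, rfl⟩
  rw [centralDiff]
  split_ifs with hx
  · refine (Finset.abs_sum_le_sum_abs _ _).trans (Finset.sum_le_sum fun i hi => ?_)
    have hi' : (i : ℝ) ≤ k := by exact_mod_cast Nat.lt_succ_iff.1 (Finset.mem_range.1 hi)
    rw [abs_mul, abs_mul, abs_pow, abs_neg, abs_one, one_pow, one_mul, Nat.abs_cast]
    refine mul_le_mul_of_nonneg_left ((hB _ ⟨?_, ?_⟩).trans (le_abs_self B)) (Nat.cast_nonneg _)
    · have := mul_nonneg (sub_nonneg.2 hi') hu.le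
      linarith [hx.1.1]
    · have := mul_nonneg (Nat.cast_nonneg (α := ℝ) i) hu.le
      linarith [hx.2.2]
  · rw [abs_zero]
    positivity

theorem modulus_mono {g : ℝ → ℝ} {a b : ℝ} (hg : ContinuousOn g (Set.Icc a b)) (k : ℕ)
    {t t' : ℝ} (h : t ≤ t') : modulus k g t a b ≤ modulus k g t' a b := by
  refine Real.sSup_le (fun y hy => ?_) (modulus_nonneg k g t' a b)
  obtain ⟨u, x, hu, hut, hx, rfl⟩ := hy
  exact le_csSup (bddAbove_modulus hg k t') ⟨u, x, hu, hut.trans h, hx, rfl⟩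

theorem abs_sum_le_modulus_of_neg {g : ℝ → ℝ} {a b : ℝ} (hg : ContinuousOn g (Set.Icc a b)) (k : ℕ)
    {t x u : ℝ} (hu : u < 0) (hut : -u ≤ t) (hx : x ∈ Set.Icc a b)
    (hxu : x + k * u ∈ Set.Icc a b) :
    |∑ i ∈ Finset.range (k + 1), (-1 : ℝ) ^ i * (k.choose i : ℝ) * g (x + i * u)| ≤
      modulus k g t a b := by
  refine le_csSup (bddAbove_modulus hg k t) ⟨-u, x + k / 2 * u, by linarith, hut, ?_, ?_⟩
  · constructor
    · linarith [hx.1, hxu.1]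
    · linarith [hx.2, hxu.2]
  · rw [centralDiff, if_pos]
    · congr 1
      refine Finset.sum_congr rfl fun i _ => ?_
      congr 2
      ring
    · rw [show x + k / 2 * u - k / 2 * -u = x + k * u by ring,
        show x + k / 2 * u + k / 2 * -u = x by ring]
      exact ⟨hxu, hx⟩

theorem neg_one_pow_mul_neg_one_pow {k i : ℕ} (h : i ≤ k) :
    (-1 : ℝ) ^ k * (-1) ^ i = (-1) ^ (k - i) := by
  rw [← pow_add, show k + i = k - i + 2 * i by omega, pow_add, pow_mul]
  simp

/-- A one-sided difference is a symmetric one about the midpoint of its extreme nodes. Positive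
steps reduce to negative ones by reversing the sum; a zero step gives the alternating binomial sum,
which vanishes because `k ≠ 0`. -/
theorem abs_sum_le_modulus {g : ℝ → ℝ} {a b : ℝ} (hg : ContinuousOn g (Set.Icc a b)) {k : ℕ}
    (hk : k ≠ 0) {t x u : ℝ} (hut : |u| ≤ t) (hx : x ∈ Set.Icc a b)
    (hxu : x + k * u ∈ Set.Icc a b) :
    |∑ i ∈ Finset.range (k + 1), (-1 : ℝ) ^ i * (k.choose i : ℝ) * g (x + i * u)| ≤
      modulus k g t a b := by
  rcases lt_trichotomy u 0 with hu | rfl | hu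
  · exact abs_sum_le_modulus_of_neg hg k hu (by rwa [abs_of_neg hu] at hut) hx hxu
  · have h : (∑ i ∈ Finset.range (k + 1), (-1 : ℝ) ^ i * (k.choose i : ℝ)) = 0 := by
      exact_mod_cast Int.alternating_sum_range_choose_of_ne hk
    simp only [mul_zero, add_zero]
    rw [← Finset.sum_mul, h, zero_mul, abs_zero]
    exact modulus_nonneg k g t a b
  · have h := abs_sum_le_modulus_of_neg hg k (t := t) (x := x + k * u) (u := -u) (by linarith)
      (by rwa [neg_neg, ← abs_of_pos hu]) hxu (by rwa [mul_neg, add_neg_cancel_right])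
    have h1 : ∑ i ∈ Finset.range (k + 1), (-1 : ℝ) ^ i * (k.choose i : ℝ) * g (x + i * u) =
        (-1) ^ k * ∑ i ∈ Finset.range (k + 1),
          (-1 : ℝ) ^ i * (k.choose i : ℝ) * g (x + k * u + i * -u) := by
      rw [← Finset.sum_range_reflect, Finset.mul_sum]
      refine Finset.sum_congr rfl fun i hi => ?_
      have hi' : i ≤ k := Nat.lt_succ_iff.1 (Finset.mem_range.1 hi)
      rw [Nat.add_sub_cancel, Nat.choose_symm hi', ← neg_one_pow_mul_neg_one_pow hi',
        Nat.cast_sub hi', show x + k * u + i * -u = x + (k - i) * u by ring]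
      ring
    rwa [h1, abs_mul, abs_pow, abs_neg, abs_one, one_pow, one_mul]

theorem fwdDiff_iterate_eq (k : ℕ) (η : ℝ) (g : ℝ → ℝ) (y : ℝ) :
    (fwdDiff η)^[k] g y = (-1) ^ k *
      ∑ i ∈ Finset.range (k + 1), (-1 : ℝ) ^ i * (k.choose i : ℝ) * g (y + i * η) := by
  rw [fwdDiff_iter_eq_sum_shift, Finset.mul_sum]
  refine Finset.sum_congr rfl fun i hi => ?_
  have hi' : i ≤ k := Nat.lt_succ_iff.1 (Finset.mem_range.1 hi)
  have h := neg_one_pow_mul_neg_one_pow hi'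
  rw [zsmul_eq_mul, nsmul_eq_mul]
  push_cast
  rw [← h]
  ring

/-! ### Smooth approximation without boundary effects -/

/-- Approximation of a continuous function by smooth ones, at the order of its modulus of
smoothness. The average runs over steps towards points of `[a, b]`, so that no boundary effect
occurs. -/
theorem exists_smooth_approx_of_continuous {G : ℝ → ℝ} (hG : Continuous G) {a b : ℝ} (hab : a < b)
    {k : ℕ} (hk : k ≠ 0) {h : ℝ} (hh : 0 < h) (hhb : h ≤ b - a) :
    ∃ E : ℕ → ℝ → ℝ, (∀ i < k, ∀ x, HasDerivAt (E i) (E (i + 1) x) x) ∧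
      ∀ x ∈ Set.Icc a b, |G x - E 0 x| ≤ modulus k G h a b ∧
        |E k x| ≤ 2 ^ k * ((k : ℝ) ^ 2 / h) ^ k * modulus k G h a b := by
  have hk0 : (0 : ℝ) < k := by exact_mod_cast Nat.pos_of_ne_zero hk
  have hk1 : (1 : ℝ) ≤ k := by exact_mod_cast Nat.pos_of_ne_zero hk
  have hba : 0 < b - a := sub_pos.2 hab
  -- The `k`th difference at `x` is taken with step θ(ζ - x), ζ in [a, b]. This step is at most h/k
  -- in size, and the last node is a convex combination of `x` and ζ because kθ ≤ 1.
  set θ : ℝ := h / (k * (b - a)) with hθ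
  have hθ0 : 0 < θ := by positivity
  have hkθ : k * θ ≤ 1 := by
    rw [hθ, ← mul_div_assoc, mul_div_mul_left _ _ hk0.ne', div_le_one hba]
    exact hhb
  have hθh : θ * (b - a) = h / k := by
    rw [hθ]
    field_simp
  have hhk : h / k ≤ h := div_le_self hh.le hk1
  -- The approximant is minus the averaged terms of that difference with positive index, shifted by
  -- one: `c i` is the signed coefficient, and the argument of `G` is α x + β + η s when ζ = a + (b
  -- - a)s/k.
  set c : ℕ → ℝ := fun i => (-1) ^ i * (k.choose (i + 1) : ℝ) with hc
  set α : ℕ → ℝ := fun i => 1 - (i + 1) * θ with hα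
  set β : ℕ → ℝ := fun i => (i + 1) * θ * a with hβ
  set η : ℕ → ℝ := fun i => (i + 1) * θ * (b - a) / k with hη
  have hη0 : ∀ i, 0 < η i := fun i => by positivity
  have hα1 : ∀ i < k, 0 ≤ α i ∧ α i ≤ 1 := fun i hi => by
    have h1 : ((i : ℝ) + 1) ≤ k := by exact_mod_cast hi
    have h2 := mul_le_mul_of_nonneg_right h1 hθ0.le
    have h3 : 0 ≤ ((i : ℝ) + 1) * θ := by positivity
    simp only [hα]
    constructor <;> linarith
  refine ⟨fun j x => ∑ i ∈ Finset.range k, c i * (α i ^ j * steklovDeriv k (η i) G j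
    (α i * x + β i)), fun j hj x => ?_, fun x hx => ⟨?_, ?_⟩⟩
  · refine HasDerivAt.fun_sum fun i _ => HasDerivAt.const_mul _ ?_
    have h1 : HasDerivAt (fun x => α i * x + β i) (α i) x := by
      simpa using ((hasDerivAt_id x).const_mul (α i)).add_const (β i)
    have h2 := ((hasDerivAt_steklovDeriv (hη0 i).ne' hG hj (α i * x + β i)).comp x h1).const_mul
      (α i ^ j)
    rw [pow_succ, mul_assoc, mul_comm (α i)]
    exact h2
  · set Φ : ℕ → ℝ → ℝ := fun i s => G (x + i * (θ * (a - x) + θ * (b - a) / k * s)) with hΦ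
    have hΦc : ∀ i, Continuous (Φ i) := fun i => by
      simp only [hΦ]
      fun_prop
    have h1 : G x - ∑ i ∈ Finset.range k, c i * (α i ^ 0 * steklovDeriv k (η i) G 0
        (α i * x + β i)) = (avg 1)^[k] (fun s => ∑ i ∈ Finset.range (k + 1),
          ((-1 : ℝ) ^ i * (k.choose i : ℝ)) * Φ i s) 0 := by
      rw [avg_iterate_sum _ _ hΦc]
      simp only
      rw [Finset.sum_range_succ']
      have h0 : (avg 1)^[k] (Φ 0) 0 = G x := by
        have : Φ 0 = fun s => G (x + 0 * s) := by
          ext s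
          simp [hΦ]
        rw [this, avg_iterate_comp]
        have h3 : ∀ n, (avg 0)^[n] G = G := fun n => by
          induction n with
          | zero => rfl
          | succ n ih =>
            rw [Function.iterate_succ_apply', ih]
            ext y
            simp [avg]
        simp [h3]
      rw [h0, sub_eq_add_neg, ← Finset.sum_neg_distrib, add_comm]
      congr 1
      · refine Finset.sum_congr rfl fun i _ => ?_
        have h4 : Φ (i + 1) = fun s => G (α i * x + β i + η i * s) := by
          ext s
          simp only [hΦ, hα, hβ, hη]
          congr 1
          push_cast
          field_simp
          ring
        rw [h4, avg_iterate_comp]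
        simp only [steklovDeriv, hc, pow_zero, one_mul, mul_zero, add_zero, Nat.sub_zero,
          Function.iterate_zero, id_eq, pow_succ]
        ring
      · simp
    rw [h1]
    refine abs_avg_iterate_le k 0 fun s hs => ?_
    rw [zero_add] at hs
    have hs1 : 0 ≤ s / k := div_nonneg hs.1 hk0.le
    have hs2 : s / k ≤ 1 := (div_le_one hk0).2 hs.2
    set ζ : ℝ := a + (b - a) * (s / k) with hζ
    have hζab : ζ ∈ Set.Icc a b := by
      constructor
      · linarith [mul_nonneg hba.le hs1]
      · linarith [mul_le_mul_of_nonneg_left hs2 hba.le]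
    have hu : θ * (a - x) + θ * (b - a) / k * s = θ * (ζ - x) := by
      rw [hζ]
      field_simp
      ring
    simp only [hΦ, hu]
    refine abs_sum_le_modulus hG.continuousOn hk ?_ hx ?_
    · rw [abs_mul, abs_of_pos hθ0]
      refine le_trans (mul_le_mul_of_nonneg_left ?_ hθ0.le) (hθh.le.trans hhk)
      rw [abs_le]
      constructor <;> linarith [hx.1, hx.2, hζab.1, hζab.2]
    · rw [show x + k * (θ * (ζ - x)) = (1 - k * θ) • x + (k * θ) • ζ by
        simp only [smul_eq_mul]; ring]
      exact convex_Icc a b hx hζab (by linarith) (by positivity) (by ring)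
  · have hM := modulus_nonneg k G h a b
    have h1 : ∀ i ∈ Finset.range k, |c i * (α i ^ k * steklovDeriv k (η i) G k (α i * x + β i))| ≤
        (k.choose (i + 1) : ℝ) * (((k : ℝ) ^ 2 / h) ^ k * modulus k G h a b) := by
      intro i hi
      have hi := Finset.mem_range.1 hi
      have hik : ((i : ℝ) + 1) ≤ k := by exact_mod_cast hi
      have hend : ∀ z ∈ Set.Icc a b, α i * x + (i + 1) * θ * z ∈ Set.Icc a b := fun z hz =>
        convex_Icc a b hx hz (hα1 i hi).1 (by positivity) (by simp only [hα]; ring)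
      rw [abs_mul, abs_mul (α i ^ k), abs_mul, abs_pow, abs_neg, abs_one, one_pow, one_mul, Nat.abs_cast]
      refine mul_le_mul_of_nonneg_left ?_ (Nat.cast_nonneg _)
      rw [← one_mul (_ * modulus k G h a b)]
      refine mul_le_mul ?_ ?_ (abs_nonneg _) zero_le_one
      · rw [abs_pow, abs_of_nonneg (hα1 i hi).1]
        exact pow_le_one₀ (hα1 i hi).1 (hα1 i hi).2
      rw [steklovDeriv, Nat.sub_self, Function.iterate_zero, id_eq, abs_mul, abs_pow, abs_inv,
        abs_of_pos (hη0 i), fwdDiff_iterate_eq, abs_mul, abs_pow, abs_neg, abs_one, one_pow,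
        one_mul]
      refine mul_le_mul ?_ ?_ (abs_nonneg _) (by positivity)
      -- Every step satisfies η ≥ θ(b - a)/k = h/k², whence the factor (k²/h)^k.
      · refine pow_le_pow_left₀ (inv_nonneg.2 (hη0 i).le) ?_ k
        rw [hη, inv_le_comm₀ (by positivity) (by positivity), inv_div]
        simp only [mul_assoc, hθh]
        rw [le_div_iff₀ hk0, div_mul_eq_mul_div, div_le_iff₀ (by positivity)]
        have : h / k * k ^ 2 = h * k := by field_simp
        nlinarith [mul_pos hh hk0]
      · refine abs_sum_le_modulus hG.continuousOn hk ?_ (hend a ⟨le_rfl, hab.le⟩) ?_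
        · rw [abs_of_pos (hη0 i)]
          refine le_trans ?_ hhk
          simp only [hη]
          refine div_le_div_of_nonneg_right ?_ hk0.le
          rw [mul_assoc, hθh]
          calc ((i : ℝ) + 1) * (h / k) ≤ k * (h / k) :=
                mul_le_mul_of_nonneg_right hik (by positivity)
            _ = h := by field_simp
        · have : α i * x + β i + k * η i = α i * x + (i + 1) * θ * b := by
            simp only [hβ, hη]
            field_simp
            ring
          rw [this]
          exact hend b ⟨hab.le, le_rfl⟩
    refine (Finset.abs_sum_le_sum_abs _ _).trans ((Finset.sum_le_sum h1).trans ?_)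
    rw [← Finset.sum_mul, mul_assoc]
    refine mul_le_mul_of_nonneg_right ?_ (by positivity)
    have h2 : (∑ i ∈ Finset.range (k + 1), (k.choose i : ℝ)) = 2 ^ k := by
      exact_mod_cast Nat.sum_range_choose k
    rw [Finset.sum_range_succ'] at h2
    rw [← h2]
    linarith [Nat.cast_nonneg (α := ℝ) (k.choose 0)]

/-- Extending `g` by its end values keeps it continuous, and the modulus sees only values on [a, b].
-/
theorem exists_smooth_approx {g : ℝ → ℝ} {a b : ℝ} (hg : ContinuousOn g (Set.Icc a b))
    (hab : a < b) {k : ℕ} (hk : k ≠ 0) {h : ℝ} (hh : 0 < h) (hhb : h ≤ b - a) :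
    ∃ E : ℕ → ℝ → ℝ, (∀ i < k, ∀ x, HasDerivAt (E i) (E (i + 1) x) x) ∧
      ∀ x ∈ Set.Icc a b, |g x - E 0 x| ≤ modulus k g h a b ∧
        |E k x| ≤ 2 ^ k * ((k : ℝ) ^ 2 / h) ^ k * modulus k g h a b := by
  have hG : Continuous (Set.IccExtend hab.le ((Set.Icc a b).domRestrict g)) :=
    (continuousOn_iff_continuous_domRestrict.1 hg).Icc_extend'
  have heq : Set.EqOn g (Set.IccExtend hab.le ((Set.Icc a b).domRestrict g)) (Set.Icc a b) :=
    fun x hx => by rw [Set.IccExtend_of_mem hab.le _ hx, Set.domRestrict_apply]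
  obtain ⟨E, hE, hE'⟩ := exists_smooth_approx_of_continuous hG hab hk hh hhb
  refine ⟨E, hE, fun x hx => ?_⟩
  rw [heq hx, modulus_congr heq]
  exact hE' x hx

/-- Prepending `r` antiderivatives to a sequence of successive derivatives. -/
theorem exists_antideriv {n : ℕ} {E : ℕ → ℝ → ℝ} (hE0 : Continuous (E 0))
    (hE : ∀ i < n, ∀ x, HasDerivAt (E i) (E (i + 1) x) x) (r : ℕ) :
    ∃ D : ℕ → ℝ → ℝ, (∀ i < r + n, ∀ x, HasDerivAt (D i) (D (i + 1) x) x) ∧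
      Continuous (D 0) ∧ ∀ i, D (r + i) = E i := by
  induction r with
  | zero => exact ⟨E, by simpa using hE, hE0, by simp⟩
  | succ r ih =>
    obtain ⟨D, hD, hD0, hDE⟩ := ih
    have hF : ∀ z, HasDerivAt (fun z => ∫ v in (0 : ℝ)..z, D 0 v) (D 0 z) z := fun z =>
      intervalIntegral.integral_hasDerivAt_right (hD0.intervalIntegrable _ _)
        (hD0.stronglyMeasurableAtFilter _ _) hD0.continuousAt
    refine ⟨fun i => Nat.casesOn i (fun z => ∫ v in (0 : ℝ)..z, D 0 v) D, ?_, ?_, ?_⟩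
    · rintro (_ | i) hi x
      · exact hF x
      · exact hD i (by omega) x
    · exact continuous_iff_continuousAt.2 fun z => (hF z).continuousAt
    · intro i
      rw [show r + 1 + i = (r + i) + 1 by omega]
      exact hDE i

/-! ### Stability of the interpolant -/

theorem pow_succ_add_le (j n : ℕ) :
    (j : ℝ) ^ (n + 1) + (n + 1) * (j : ℝ) ^ n ≤ ((j : ℝ) + 1) ^ (n + 1) := by
  induction n with
  | zero => simp
  | succ n ih =>
    have h1 := mul_le_mul_of_nonneg_right ih (show (0 : ℝ) ≤ (j : ℝ) + 1 by positivity)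
    have h2 : (0 : ℝ) ≤ (n + 1) * (j : ℝ) ^ n := by positivity
    rw [pow_succ ((j : ℝ) + 1)]
    refine le_trans ?_ h1
    push_cast
    linear_combination h2

/-- By Leibniz the derivative is a sum of at most j^n products of `j - n` distances. The factor (b -
a)^n on the left avoids the truncated exponent `j - n`. -/
theorem abs_eval_iterate_derivative_nodePoly_le {a b t : ℝ} (ht : t ∈ Set.Icc a b) {x : ℕ → ℝ}
    (hab : ∀ i, x i ∈ Set.Icc a b) (s j n : ℕ) :
    |(derivative^[n] (nodePoly x s j)).eval t| * (b - a) ^ n ≤ (j : ℝ) ^ n * (b - a) ^ j := by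
  have hba : 0 ≤ b - a := sub_nonneg.2 (ht.1.trans ht.2)
  induction j generalizing n with
  | zero =>
    rcases n with _ | n
    · simp [nodePoly]
    · simp [nodePoly, iterate_derivative_one]
  | succ j ih =>
    have htx : |t - x (s + j)| ≤ b - a := by
      have := hab (s + j)
      rw [abs_le]
      constructor <;> linarith [ht.1, ht.2, this.1, this.2]
    rw [nodePoly_succ]
    rcases n with _ | n
    · have h := ih 0
      simp only [Function.iterate_zero, id_eq, pow_zero, mul_one, one_mul, eval_mul, eval_sub,
        eval_X, eval_C, abs_mul] at h ⊢
      rw [pow_succ]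
      exact mul_le_mul h htx (abs_nonneg _) (by positivity)
    · have h1 : (derivative^[n + 1] (nodePoly x s j * (X - C (x (s + j))))).eval t =
          (derivative^[n + 1] (nodePoly x s j)).eval t * (t - x (s + j)) +
            (n + 1) * (derivative^[n] (nodePoly x s j)).eval t := by
        rw [mul_sub, mul_comm _ (C _), iterate_derivative_sub, iterate_derivative_mul_X,
          iterate_derivative_C_mul]
        simp
        ring
      rw [h1]
      calc _ ≤ (|(derivative^[n + 1] (nodePoly x s j)).eval t| * (b - a) +
            (n + 1) * |(derivative^[n] (nodePoly x s j)).eval t|) * (b - a) ^ (n + 1) := by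
            refine mul_le_mul_of_nonneg_right ((abs_add_le _ _).trans (add_le_add ?_ ?_))
              (by positivity)
            · rw [abs_mul]
              exact mul_le_mul_of_nonneg_left htx (abs_nonneg _)
            · rw [abs_mul, abs_of_nonneg (by positivity : (0 : ℝ) ≤ (n : ℝ) + 1)]
        _ = (|(derivative^[n + 1] (nodePoly x s j)).eval t| * (b - a) ^ (n + 1) +
            (n + 1) * (|(derivative^[n] (nodePoly x s j)).eval t| * (b - a) ^ n)) * (b - a) := by
            ring
        _ ≤ ((j : ℝ) ^ (n + 1) * (b - a) ^ j + (n + 1) * ((j : ℝ) ^ n * (b - a) ^ j)) *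
            (b - a) := by
            refine mul_le_mul_of_nonneg_right (add_le_add (ih _) ?_) hba
            exact mul_le_mul_of_nonneg_left (ih _) (by positivity)
        _ = ((j : ℝ) ^ (n + 1) + (n + 1) * (j : ℝ) ^ n) * (b - a) ^ (j + 1) := by ring
        _ ≤ _ := by
            push_cast
            exact mul_le_mul_of_nonneg_right (pow_succ_add_le j n) (by positivity)

section Stability

variable {a b lam M : ℝ} {m r : ℕ} {x : ℕ → ℝ} {D : ℕ → ℝ → ℝ} {P : ℝ[X]}

/-- Order `r` is the mean value theorem. Every later order subtracts two coefficients and divides by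
a knot gap spanning at least `r + 1` indices, hence of length at least λ(b - a). -/
theorem abs_newtonCoeff_le (hab : a < b) (hlam : 0 < lam) (hx : Monotone x)
    (hxab : ∀ i, x i ∈ Set.Icc a b)
    (hsep : ∀ s, s + (r + 1) < m → lam * (b - a) ≤ x (s + (r + 1)) - x s)
    (hD : IsDerivChain r D a b) (hP : Interpolates P D (nodeMultiset x 0 m))
    (hM : ∀ t ∈ Set.Icc a b, |D r t| ≤ M) (j s : ℕ) (hs : s + (r + j) < m) :
    |newtonCoeff x P s (r + j)| ≤ (2 / (lam * (b - a))) ^ j * M := by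
  have hlb : 0 < lam * (b - a) := mul_pos hlam (sub_pos.2 hab)
  induction j generalizing s with
  | zero =>
    obtain ⟨ξ, hξ, h⟩ := IsDerivChain.exists_eq_factorial_mul_newtonCoeff hx hxab (s := s) hD
      (hP.mono (nodeMultiset_mono x (Nat.zero_le s) (by omega)))
    have h1 := hM ξ hξ
    rw [h, abs_mul, Nat.abs_cast] at h1
    rw [pow_zero, one_mul, add_zero]
    refine le_trans (le_mul_of_one_le_left (abs_nonneg _) ?_) h1
    exact_mod_cast Nat.one_le_iff_ne_zero.2 (Nat.factorial_ne_zero r)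
  | succ j ih =>
    have h1 : lam * (b - a) ≤ x (s + (r + j + 1)) - x s :=
      (hsep s (by omega)).trans (sub_le_sub_right (hx (by omega)) _)
    have h2 : 0 < x (s + (r + j + 1)) - x s := hlb.trans_le h1
    rw [← add_assoc, newtonCoeff_succ x P s (r + j) (sub_pos.1 h2).ne, abs_div, abs_of_pos h2,
      div_le_iff₀ h2]
    have hM0 : 0 ≤ (2 / (lam * (b - a))) ^ j * M :=
      (abs_nonneg _).trans (ih s (by omega))
    calc _ ≤ |newtonCoeff x P (s + 1) (r + j)| + |newtonCoeff x P s (r + j)| := abs_sub _ _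
      _ ≤ 2 * ((2 / (lam * (b - a))) ^ j * M) := by
          linarith [ih (s + 1) (by omega), ih s (by omega)]
      _ = (2 / (lam * (b - a))) ^ (j + 1) * M * (lam * (b - a)) := by
          rw [pow_succ, mul_right_comm _ _ M, mul_assoc _ _ (lam * (b - a)),
            div_mul_cancel₀ _ hlb.ne']
          ring
      _ ≤ _ := by
          refine mul_le_mul_of_nonneg_left h1 ?_
          rw [pow_succ, mul_right_comm]
          positivity

/-- Stability of Hermite interpolation: the `r`th derivative of the interpolant is bounded in
terms of the `r`th derivative of the function. -/
theorem abs_eval_iterate_derivative_modByMonic_le (hab : a < b) (hlam : 0 < lam) (hlam1 : lam ≤ 1)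
    (hm : 1 ≤ m) (hrm : r ≤ m) (hx : Monotone x) (hxab : ∀ i, x i ∈ Set.Icc a b)
    (hsep : ∀ s, s + (r + 1) < m → lam * (b - a) ≤ x (s + (r + 1)) - x s)
    (hD : IsDerivChain r D a b) (hP : Interpolates P D (nodeMultiset x 0 m))
    (hM : ∀ t ∈ Set.Icc a b, |D r t| ≤ M) {t : ℝ} (ht : t ∈ Set.Icc a b) :
    |(derivative^[r] (P %ₘ nodePoly x 0 m)).eval t| ≤ m * ((2 / lam) ^ m * m ^ m * M) := by
  have hM0 : 0 ≤ M := (abs_nonneg _).trans (hM t ht)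
  have hba : 0 < b - a := sub_pos.2 hab
  have hl : 1 ≤ 2 / lam := by rw [le_div_iff₀ hlam]; linarith
  have hm1 : (1 : ℝ) ≤ m := by exact_mod_cast hm
  rw [modByMonic_nodePoly_eq_sum, iterate_derivative_sum, eval_finsetSum]
  refine (Finset.abs_sum_le_sum_abs _ _).trans ?_
  refine le_of_le_of_eq (Finset.sum_le_card_nsmul _ _ ((2 / lam) ^ m * m ^ m * M)
    fun j hj => ?_) (by rw [Finset.card_range, nsmul_eq_mul])
  rw [iterate_derivative_C_mul, eval_mul, eval_C, abs_mul]
  -- Newton terms of degree below `r` are killed by the derivative; in the others the powers of b -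
  -- a cancel.
  rcases lt_or_ge j r with hjr | hjr
  · rw [iterate_derivative_eq_zero (by rwa [nodePoly_natDegree]), eval_zero, abs_zero, mul_zero]
    positivity
  obtain ⟨i, rfl⟩ := Nat.exists_eq_add_of_le hjr
  have hj' := Finset.mem_range.1 hj
  have h1 := abs_newtonCoeff_le hab hlam hx hxab hsep hD hP hM i 0 (by omega)
  have h2 := abs_eval_iterate_derivative_nodePoly_le ht hxab 0 (r + i) r
  rw [pow_add, mul_comm ((b - a) ^ r), ← mul_assoc] at h2
  have h2 := le_of_mul_le_mul_right h2 (pow_pos hba r)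
  calc _ ≤ ((2 / (lam * (b - a))) ^ i * M) * (((r + i : ℕ) : ℝ) ^ r * (b - a) ^ i) :=
        mul_le_mul h1 h2 (abs_nonneg _) (by positivity)
    _ = (2 / lam) ^ i * ((r + i : ℕ) : ℝ) ^ r * M := by
        rw [← div_div, div_pow (2 / lam)]
        field_simp
    _ ≤ _ := by
        refine mul_le_mul_of_nonneg_right (mul_le_mul ?_ ?_ (by positivity) (by positivity)) hM0
        · exact pow_le_pow_right₀ hl (by omega)
        · calc ((r + i : ℕ) : ℝ) ^ r ≤ (m : ℝ) ^ r :=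
                pow_le_pow_left₀ (by positivity) (by exact_mod_cast hj'.le) r
            _ ≤ _ := pow_le_pow_right₀ hm1 hrm

end Stability

/-! ### From finite node families to sequences; the Hermite polynomial -/

/-- The finite sequence `X`, continued by its last term. -/
def extendNodes {m : ℕ} (hm : 0 < m) (X : Fin m → ℝ) (l : ℕ) : ℝ :=
  X ⟨min l (m - 1), by omega⟩

theorem extendNodes_eq {m : ℕ} (hm : 0 < m) (X : Fin m → ℝ) {l : ℕ} (hl : l < m) :
    extendNodes hm X l = X ⟨l, hl⟩ := by
  rw [extendNodes]
  congr 2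
  omega

theorem extendNodes_monotone {m : ℕ} (hm : 0 < m) {X : Fin m → ℝ} (hX : Monotone X) :
    Monotone (extendNodes hm X) := fun i j hij =>
  hX (Fin.mk_le_mk.2 (by omega))

theorem nodeMultiset_extendNodes {m : ℕ} (hm : 0 < m) (X : Fin m → ℝ) :
    nodeMultiset (extendNodes hm X) 0 m = Finset.univ.val.map X := by
  have h : Finset.Ico 0 (0 + m) = Finset.univ.map (Fin.valEmbedding (n := m)) := by
    ext k
    simp only [Finset.mem_Ico, Finset.mem_map, Finset.mem_univ, true_and, Fin.valEmbedding_apply]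
    exact ⟨fun hk => ⟨⟨k, by omega⟩, rfl⟩, by rintro ⟨i, rfl⟩; omega⟩
  rw [nodeMultiset, h, Finset.map_val, Multiset.map_map]
  exact Multiset.map_congr rfl fun i _ => extendNodes_eq hm X i.isLt

theorem hermitePoly_eq_modByMonic {f : ℝ → ℝ} {I : Set ℝ} {m : ℕ} (hm : 0 < m) {X : Fin m → ℝ}
    (hX : Monotone X) {F : ℝ[X]}
    (hF : Interpolates F (fun j => iteratedDerivWithin j f I) (Finset.univ.val.map X)) :
    hermitePoly f I X = F %ₘ nodePoly (extendNodes hm X) 0 m := by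
  rw [← nodeMultiset_extendNodes hm] at hF
  rw [modByMonic_nodePoly_eq_sum, hermitePoly, ← Fin.sum_univ_eq_sum_range
    (fun j => C (newtonCoeff (extendNodes hm X) F 0 j) * nodePoly (extendNodes hm X) 0 j)]
  refine Finset.sum_congr rfl fun j _ => ?_
  refine congrArg₂ (· * ·) (congrArg C ?_) ?_
  · rw [← divDiff_eq_newtonCoeff (extendNodes_monotone hm hX) j 0
      (hF.mono (nodeMultiset_mono _ le_rfl (by omega)))]
    congr 1
    ext i
    rw [zero_add, extendNodes_eq hm X (by omega)]
    rfl
  · rw [nodePoly]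
    refine Finset.prod_bij (fun i _ => (i : ℕ)) ?_ ?_ ?_ ?_
    · intro i hi
      simpa using hi
    · intro i _ k _ h
      exact Fin.ext h
    · intro k hk
      have hk := Finset.mem_range.1 hk
      exact ⟨⟨k, by omega⟩, by
        rw [Finset.mem_filter]
        exact ⟨Finset.mem_univ _, hk⟩, rfl⟩
    · intro i _
      rw [zero_add, extendNodes_eq hm X i.isLt]

theorem repIndex_lt_count {m : ℕ} (X : Fin m → ℝ) (j : Fin m) :
    repIndex X j < (Finset.univ.val.map X).count (X j) := by
  classical
  rw [Multiset.count_map, repIndex, ← Finset.filter_val, Finset.card_val]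
  refine Finset.card_lt_card ((Finset.ssubset_iff_of_subset fun i hi => ?_).2 ⟨j, ?_, ?_⟩)
  · simp only [Finset.mem_filter, Finset.mem_univ, true_and] at hi ⊢
    exact hi.2.symm
  · simp
  · simp

theorem Interpolates.isHermiteInterpolant {f : ℝ → ℝ} {I : Set ℝ} {m : ℕ} {X : Fin m → ℝ}
    {L : ℝ[X]} (hL : L.degree < (m : WithBot ℕ))
    (h : Interpolates L (fun j => iteratedDerivWithin j f I) (Finset.univ.val.map X)) :
    IsHermiteInterpolant f I X L :=
  ⟨hL, fun j => h (X j) _ (repIndex_lt_count X j)⟩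

theorem isDerivChain_iteratedDerivWithin {f : ℝ → ℝ} {a b : ℝ} (hab : a < b) {r : ℕ}
    (hf : ContDiffOn ℝ (r : WithTop ℕ∞) f (Set.Icc a b)) :
    IsDerivChain r (fun j => iteratedDerivWithin j f (Set.Icc a b)) a b := fun i hi x hx => by
  have h := hf.differentiableOn_iteratedDerivWithin (m := i) (by exact_mod_cast hi)
    (uniqueDiffOn_Icc hab) x hx
  simp only [iteratedDerivWithin_succ]
  exact h.hasDerivWithinAt

/-! ### Products of distances to the nodes -/

section NearProd

variable {m : ℕ} (X : Fin m → ℝ) (x : ℝ) (σ : Equiv.Perm (Fin m))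

/-- The `n` points of `X` that come first in the order `σ`. -/
noncomputable def nearMultiset (n : ℕ) : Multiset ℝ :=
  (Finset.univ.filter fun ν : Fin m => (ν : ℕ) < n).val.map fun ν => X (σ ν)

theorem univ_map_perm : Finset.univ.val.map (fun ν => X (σ ν)) = Finset.univ.val.map X := by
  have h := congrArg (Multiset.map X) (Multiset.map_univ_val_equiv σ)
  rwa [Multiset.map_map] at h

theorem nearMultiset_le (n : ℕ) : nearMultiset X σ n ≤ Finset.univ.val.map X := by
  rw [← univ_map_perm X σ]
  exact Multiset.map_le_map (Finset.val_le_iff.2 (Finset.filter_subset _ _))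

theorem card_nearMultiset {n : ℕ} (hn : n ≤ m) : (nearMultiset X σ n).card = n := by
  rw [nearMultiset, Multiset.card_map, Finset.card_val, Fin.card_filter_val_lt]
  exact min_eq_right hn

theorem prod_nearMultiset (n : ℕ) :
    ((nearMultiset X σ n).map fun c => |x - c|).prod = nearProd X x σ n := by
  rw [nearMultiset, Multiset.map_map]
  rfl

theorem nearProd_nonneg (n : ℕ) : 0 ≤ nearProd X x σ n :=
  Finset.prod_nonneg fun _ _ => abs_nonneg _

theorem nearProd_succ {n : ℕ} (hn : n < m) :
    nearProd X x σ (n + 1) = nearProd X x σ n * |x - X (σ ⟨n, hn⟩)| := by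
  have h : (Finset.univ.filter fun ν : Fin m => (ν : ℕ) < n + 1) =
      insert ⟨n, hn⟩ (Finset.univ.filter fun ν : Fin m => (ν : ℕ) < n) := by
    ext ν
    simp only [Finset.mem_filter, Finset.mem_univ, true_and, Finset.mem_insert, Fin.ext_iff]
    omega
  rw [nearProd, h, Finset.prod_insert (by simp), mul_comm, nearProd]

theorem nearProd_add_le {B : ℝ} (hB : ∀ j, |x - X j| ≤ B) {n k : ℕ} (h : n + k ≤ m) :
    nearProd X x σ (n + k) ≤ nearProd X x σ n * B ^ k := by
  induction k with
  | zero => simp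
  | succ k ih =>
    rw [← add_assoc, nearProd_succ X x σ (by omega), pow_succ, ← mul_assoc]
    exact mul_le_mul (ih (by omega)) (hB _) (abs_nonneg _)
      ((nearProd_nonneg _ _ _ _).trans (ih (by omega)))

end NearProd

/-! ### The error estimate -/

/-- The error of Hermite interpolation, at a point `x` whose distance to the `(r + 1)`st nearest
node is `d > 0`, with a step `h` such that `h ^ (m - r) = |I| ^ (m - r - 1) d`. -/
theorem abs_sub_eval_hermite_le {m r : ℕ} (hrm : r < m) {lam : ℝ} (hlam : 0 < lam)
    (hlam1 : lam ≤ 1) {X : Fin m → ℝ} (hX : Monotone X) {a b : ℝ} (hab : a < b)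
    (hXab : ∀ j, X j ∈ Set.Icc a b)
    (hsep : ∀ i j : Fin m, (j : ℕ) = (i : ℕ) + r + 1 → lam * (b - a) ≤ X j - X i)
    {D : ℕ → ℝ → ℝ} (hD : IsDerivChain r D a b) (hDc : ContinuousOn (D r) (Set.Icc a b))
    {L : ℝ[X]} (hL : L.degree < (m : WithBot ℕ)) (hLD : Interpolates L D (Finset.univ.val.map X))
    {x : ℝ} (hx : x ∈ Set.Icc a b) (σ : Equiv.Perm (Fin m)) {h : ℝ} (hh : 0 < h)
    (hhb : h ≤ b - a)
    (hpow : h ^ (m - r) = (b - a) ^ (m - r - 1) * |x - X (σ ⟨r, hrm⟩)|) :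
    |D 0 x - L.eval x| ≤ (1 + m * ((2 / lam) ^ m * m ^ m) + 2 ^ m * ((m : ℝ) ^ 2) ^ m) *
      nearProd X x σ r * modulus (m - r) (D r) h a b := by
  have hm : 0 < m := by omega
  have hba : 0 < b - a := sub_pos.2 hab
  obtain ⟨k, hmdef⟩ : ∃ k, m = r + (k + 1) := ⟨m - r - 1, by omega⟩
  have hk : m - r = k + 1 := by omega
  rw [hk] at hpow ⊢
  rw [Nat.add_sub_cancel] at hpow
  set ω := modulus (k + 1) (D r) h a b with hω
  have hω0 : 0 ≤ ω := modulus_nonneg _ _ _ _ _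
  have hN0 := nearProd_nonneg X x σ r
  obtain ⟨E, hE, hEω⟩ := exists_smooth_approx hDc hab (Nat.succ_ne_zero k) hh hhb
  obtain ⟨D₂, hD₂, -, hD₂E⟩ := exists_antideriv
    (continuous_iff_continuousAt.2 fun z => (hE 0 (Nat.succ_pos k) z).continuousAt) hE r
  have hD₂c : IsDerivChain m D₂ a b := fun i hi z _ =>
    (hD₂ i (by omega) z).hasDerivWithinAt
  set x' := extendNodes hm X with hx'
  have hx'm : Monotone x' := extendNodes_monotone hm hX
  have hx'ab : ∀ i, x' i ∈ Set.Icc a b := fun i => hXab _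
  have hS : nodeMultiset x' 0 m = Finset.univ.val.map X := nodeMultiset_extendNodes hm X
  have hSab : ∀ c ∈ Finset.univ.val.map X, c ∈ Set.Icc a b := fun c hc => by
    obtain ⟨j, -, rfl⟩ := Multiset.mem_map.1 hc
    exact hXab j
  rw [← hS] at hLD
  -- `L₂` interpolates the smooth part `D₂`, so `L - L₂` interpolates the rough part; it is its own
  -- remainder, to which stability applies.
  obtain ⟨F₂, hF₂⟩ := exists_interpolates (nodeMultiset x' 0 m) D₂
  set L₂ := F₂ %ₘ nodePoly x' 0 m with hL₂
  have hL₂D : Interpolates L₂ D₂ (nodeMultiset x' 0 m) := hF₂.modByMonic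
  have hL₂deg : L₂.degree < (m : WithBot ℕ) := degree_modByMonic_nodePoly_lt x' F₂ 0 m
  have hL₁D := hLD.sub hL₂D
  have hL₁ : (L - L₂) %ₘ nodePoly x' 0 m = L - L₂ := by
    rw [modByMonic_eq_self_iff (nodePoly_monic _ _ _), nodePoly_degree]
    exact (degree_sub_le _ _).trans_lt (max_lt hL hL₂deg)
  have hD₁ : IsDerivChain r (fun s c => D s c - D₂ s c) a b := hD.sub (hD₂c.mono (by omega))
  have hD₁ω : ∀ t ∈ Set.Icc a b, |D r t - D₂ r t| ≤ ω := fun t ht => by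
    have h1 := hD₂E 0
    rw [add_zero] at h1
    rw [h1]
    exact (hEω t ht).1
  have hsep' : ∀ s, s + (r + 1) < m → lam * (b - a) ≤ x' (s + (r + 1)) - x' s := fun s hs => by
    rw [hx', extendNodes_eq hm X hs, extendNodes_eq hm X (show s < m by omega)]
    exact hsep _ _ (by simp only; omega)
  -- The rough part has only `r` controlled derivatives, so only `r` of the zeros of its error are
  -- used.
  have hrough : |(D 0 x - D₂ 0 x) - (L - L₂).eval x| ≤
      (ω + m * ((2 / lam) ^ m * m ^ m * ω)) * nearProd X x σ r := by
    rw [← prod_nearMultiset]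
    refine (hD₁.sub (isDerivChain_polynomial (L - L₂) r a b)).abs_le_mul_prod
      (card_nearMultiset X σ (by omega))
      (fun c hc => hSab c (Multiset.mem_of_le (nearMultiset_le X σ r) hc)) (fun c s hs => ?_) hx
      fun t ht => (abs_sub _ _).trans (add_le_add (hD₁ω t ht) ?_)
    · rw [hL₁D c s (by rw [hS]; exact hs.trans_le (Multiset.count_le_of_le _
        (nearMultiset_le X σ r))), sub_self]
    · rw [← hL₁]
      exact abs_eval_iterate_derivative_modByMonic_le hab hlam hlam1 hm (by omega) hx'm hx'ab hsep'
        hD₁ hL₁D hD₁ω ht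
  have hd : 0 < |x - X (σ ⟨r, hrm⟩)| := by
    by_contra hd
    rw [le_antisymm (not_lt.1 hd) (abs_nonneg _), mul_zero] at hpow
    exact (pow_pos hh _).ne' hpow
  -- All `m` zeros are used, and the `m`th derivative of `L₂` vanishes. The distances after the
  -- first `r` contribute at most d(b - a)^k = h^(k+1), which absorbs the negative power of `h`.
  have hsmooth : |D₂ 0 x - L₂.eval x| ≤
      2 ^ m * ((m : ℝ) ^ 2) ^ m * nearProd X x σ r * ω := by
    have h1 : |D₂ 0 x - L₂.eval x| ≤ (2 ^ (k + 1) * (((k + 1 : ℕ) : ℝ) ^ 2 / h) ^ (k + 1) * ω) *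
        nearProd X x σ m := by
      rw [← prod_nearMultiset]
      refine (hD₂c.sub (isDerivChain_polynomial L₂ m a b)).abs_le_mul_prod
        (card_nearMultiset X σ le_rfl)
        (fun c hc => hSab c (Multiset.mem_of_le (nearMultiset_le X σ m) hc)) (fun c s hs => ?_) hx
        fun t ht => ?_
      · rw [hL₂D c s (by rw [hS]; exact hs.trans_le (Multiset.count_le_of_le _
          (nearMultiset_le X σ m))), sub_self]
      · rw [iterate_derivative_eq_zero_of_degree_lt hL₂deg, eval_zero, sub_zero, hmdef, hD₂E]
        exact (hEω t ht).2
    have h2 : nearProd X x σ m ≤ nearProd X x σ r * h ^ (k + 1) := by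
      have hB : ∀ j, |x - X j| ≤ b - a := fun j => by
        have := hXab j
        rw [abs_le]
        constructor <;> linarith [hx.1, hx.2, this.1, this.2]
      have h3 := nearProd_add_le X x σ hB (n := r + 1) (k := k) (by omega)
      rw [nearProd_succ X x σ (by omega), show r + 1 + k = m by omega] at h3
      rw [hpow]
      linarith
    have hkm : ((k + 1 : ℕ) : ℝ) ≤ m := by exact_mod_cast (by omega : k + 1 ≤ m)
    have hm1 : (1 : ℝ) ≤ m := by exact_mod_cast hm
    refine h1.trans ?_
    calc _ ≤ (2 ^ (k + 1) * (((k + 1 : ℕ) : ℝ) ^ 2 / h) ^ (k + 1) * ω) *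
          (nearProd X x σ r * h ^ (k + 1)) :=
          mul_le_mul_of_nonneg_left h2 (by positivity)
      _ = 2 ^ (k + 1) * (((k + 1 : ℕ) : ℝ) ^ 2) ^ (k + 1) * nearProd X x σ r * ω := by
          rw [div_pow]
          field_simp
      _ ≤ _ := by
          refine mul_le_mul_of_nonneg_right (mul_le_mul_of_nonneg_right (mul_le_mul
            (pow_le_pow_right₀ one_le_two (by omega)) ?_ (by positivity) (by positivity)) hN0) hω0
          exact (pow_le_pow_left₀ (by positivity)
            (pow_le_pow_left₀ (by positivity) hkm 2) _).trans
            (pow_le_pow_right₀ (one_le_pow₀ hm1) (by omega))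
  calc |D 0 x - L.eval x| = |((D 0 x - D₂ 0 x) - (L - L₂).eval x) + (D₂ 0 x - L₂.eval x)| := by
        rw [eval_sub]
        congr 1
        ring
    _ ≤ _ := (abs_add_le _ _).trans (add_le_add hrough hsmooth)
    _ = _ := by ring

end HermiteInterp

/-! ### The main theorem -/

theorem corollary4 (m : ℕ) (lam : ℝ) (hlam0 : 0 < lam) (hlam1 : lam ≤ 1) :
    ∃ C : ℝ, 0 < C ∧
      ∀ (r : ℕ) (hr : r + 2 ≤ m) (X : Fin m → ℝ) (a b : ℝ),
        Monotone X →
        a = X ⟨0, by omega⟩ →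
        b = X ⟨m - 1, by omega⟩ →
        a < b →
        (∀ i j : Fin m, (j : ℕ) = (i : ℕ) + r + 1 → lam * (b - a) ≤ X j - X i) →
        ∀ f : ℝ → ℝ, ContDiffOn ℝ (r : WithTop ℕ∞) f (Set.Icc a b) →
          HermiteInterp.IsHermiteInterpolant f (Set.Icc a b) X
            (HermiteInterp.hermitePoly f (Set.Icc a b) X) ∧
          ∀ x ∈ Set.Icc a b, ∀ σ : Equiv.Perm (Fin m), HermiteInterp.IsNearestOrder X x σ →
            |f x - (HermiteInterp.hermitePoly f (Set.Icc a b) X).eval x| ≤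
                C * HermiteInterp.nearProd X x σ r *
                  HermiteInterp.modulus (m - r) (iteratedDerivWithin r f (Set.Icc a b))
                    ((b - a) * (|x - X (σ ⟨r, by omega⟩)| / (b - a)) ^ (1 / ((m : ℝ) - (r : ℝ))))
                    a b ∧
            C * HermiteInterp.nearProd X x σ r *
                  HermiteInterp.modulus (m - r) (iteratedDerivWithin r f (Set.Icc a b))
                    ((b - a) * (|x - X (σ ⟨r, by omega⟩)| / (b - a)) ^ (1 / ((m : ℝ) - (r : ℝ))))
                    a b ≤
                C * HermiteInterp.nearProd X x σ r *
                  HermiteInterp.modulus (m - r) (iteratedDerivWithin r f (Set.Icc a b))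
                    (b - a) a b := by
  -- The first two terms bound the rough part and its interpolant, the last one the smooth part;
  -- exponents are raised to `m` so that the constant does not depend on `r`.
  refine ⟨1 + m * ((2 / lam) ^ m * m ^ m) + 2 ^ m * ((m : ℝ) ^ 2) ^ m, by positivity, ?_⟩
  intro r hr X a b hX ha hb hab hsep f hf
  have hm : 0 < m := by omega
  have hba : 0 < b - a := sub_pos.2 hab
  have hXab : ∀ j, X j ∈ Set.Icc a b := fun j => by
    rw [ha, hb]
    exact ⟨hX (Fin.mk_le_mk.2 (Nat.zero_le _)), hX (Fin.mk_le_mk.2 (by omega))⟩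
  have hDc : ContinuousOn (iteratedDerivWithin r f (Set.Icc a b)) (Set.Icc a b) :=
    hf.continuousOn_iteratedDerivWithin le_rfl (uniqueDiffOn_Icc hab)
  obtain ⟨F, hF⟩ := HermiteInterp.exists_interpolates (Finset.univ.val.map X)
    (fun j => iteratedDerivWithin j f (Set.Icc a b))
  have hLF := HermiteInterp.hermitePoly_eq_modByMonic hm hX hF
  have hL : HermiteInterp.Interpolates (HermiteInterp.hermitePoly f (Set.Icc a b) X)
      (fun j => iteratedDerivWithin j f (Set.Icc a b)) (Finset.univ.val.map X) := by
    rw [hLF]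
    rw [← HermiteInterp.nodeMultiset_extendNodes hm] at hF ⊢
    exact hF.modByMonic
  have hLdeg : (HermiteInterp.hermitePoly f (Set.Icc a b) X).degree < (m : WithBot ℕ) := by
    rw [hLF]
    exact HermiteInterp.degree_modByMonic_nodePoly_lt _ F 0 m
  refine ⟨hL.isHermiteInterpolant hLdeg, fun x hx σ _ => ?_⟩
  set d := |x - X (σ ⟨r, by omega⟩)| with hd
  have hd0 : 0 ≤ d := abs_nonneg _
  have hdb : d / (b - a) ≤ 1 := by
    have := hXab (σ ⟨r, by omega⟩)
    rw [div_le_one hba, hd, abs_le]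
    constructor <;> linarith [hx.1, hx.2, this.1, this.2]
  have hk : ((m : ℝ) - r) = ((m - r : ℕ) : ℝ) := (Nat.cast_sub (by omega)).symm
  have hk0 : m - r ≠ 0 := by omega
  rw [hk, one_div]
  have hN0 := HermiteInterp.nearProd_nonneg X x σ r
  have hhb : (b - a) * (d / (b - a)) ^ (((m - r : ℕ) : ℝ)⁻¹) ≤ b - a :=
    mul_le_of_le_one_right hba.le (Real.rpow_le_one (by positivity) hdb (by positivity))
  refine ⟨?_, mul_le_mul_of_nonneg_left (HermiteInterp.modulus_mono hDc _ hhb) (by positivity)⟩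
  -- If d = 0 there is no positive step to average over, but then `x` is a node and the error is
  -- zero.
  rcases hd0.eq_or_lt with h0 | h0
  · have hxX : x = X (σ ⟨r, by omega⟩) := sub_eq_zero.1 (abs_eq_zero.1 h0.symm)
    have h1 := hL x 0 (Multiset.count_pos.2 (Multiset.mem_map.2
      ⟨_, Finset.mem_univ_val _, hxX.symm⟩))
    simp only [Function.iterate_zero, id_eq, iteratedDerivWithin_zero] at h1
    rw [h1, sub_self, abs_zero]
    exact mul_nonneg (by positivity) (HermiteInterp.modulus_nonneg _ _ _ _ _)
  · have h1 := HermiteInterp.abs_sub_eval_hermite_le (by omega) hlam0 hlam1 hX hab hXab hsep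
      (HermiteInterp.isDerivChain_iteratedDerivWithin hab hf) hDc hLdeg hL hx σ
      (h := (b - a) * (d / (b - a)) ^ (((m - r : ℕ) : ℝ)⁻¹)) (by positivity) hhb (by
        rw [mul_pow, Real.rpow_inv_natCast_pow (by positivity) hk0,
          show m - r = m - r - 1 + 1 by omega, pow_succ, Nat.add_sub_cancel,
          mul_assoc, mul_div_cancel₀ _ hba.ne'])
    simpa only [iteratedDerivWithin_zero] using h1
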